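/- Fix $d\ge 1$, $\alpha\ge 1$, $t_{\mathrm{fin}}>0$, $a>0$ and a sequence $\chi_N>0$ with $\chi_N\to 0$. Let $\mathbb{T}^d_N=\{0,\frac1N,\dots,\frac{N-1}{N}\}^d$ be the rescaled discrete torus, and let $\eta^N_\bullet$ be the rescaled zero-range process, that is, the càdlàg Markov jump process on $X_N=(\chi_N\mathbb{N})^{\mathbb{T}^d_N}$ (with $0\in\mathbb{N}$) with generator $N^2\mathcal{L}_N$, $$\mathcal{L}_NF(\eta)=\frac12\sum_{x\sim y}\frac{\eta(x)^\alpha}{\chi_N}\big(F(\eta+\chi_N1_y-\chi_N1_x)-F(\eta)\big),$$ where the sum runs over all ordered pairs of nearest neighbours in $\mathbb{T}^d_N$. For each $N$, let the initial state $\eta^N_0$ be distributed according to the equilibrium distribution $$\Pi^N_a(\eta)=\prod_{x\in\mathbb{T}^d_N}\frac{(a/\chi_N)^{\alpha\,\eta(x)/\chi_N}}{\big((\eta(x)/\chi_N)!\big)^\alpha\,Z_\alpha(a/\chi_N)},\qquad Z_\alpha(u)=\sum_{j\ge0}\frac{u^{\alpha j}}{(j!)^\alpha}.$$ For $\epsilon>0$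 let $$\overline{\eta}^{N,N\epsilon}(x)=\frac1{(2\lfloor\epsilon N\rfloor+1)^d}\sum_{y\in B_{\lfloor\epsilon N\rfloor}(x)}\eta(y)$$ be the average of $\eta$ over the lattice box $B_{\lfloor\epsilon N\rfloor}(x)$ of microscopic side length $2\lfloor\epsilon N\rfloor+1$ centred at $x$, and let $V^N_\alpha(\eta,\epsilon,x)=\big|\eta(x)^\alpha-(\overline{\eta}^{N,N\epsilon}(x))^\alpha\big|$. Then, for every $\delta>0$, $$\limsup_{\epsilon\to0}\limsup_{N\to\infty}\frac{\chi_N}{N^d}\log\mathbb{P}\left(\int_0^{t_{\mathrm{fin}}}\frac1{N^d}\sum_{x\in\mathbb{T}^d_N}V^N_\alpha(\eta^N_t,\epsilon,x)\,dt>\delta\right)=-\infty .$$ -/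

import Mathlib

open MeasureTheory ProbabilityTheory Filter Topology
open scoped ENNReal Nat BigOperators

namespace ZeroRange

/-- The discrete torus of side `N` in dimension `d`; the site `x : Torus d N` stands for the
point `x / N` of the rescaled torus `{0, 1/N, …, (N-1)/N}^d`. -/
abbrev Torus (d N : ℕ) : Type := Fin d → ZMod N

/-- Particle configurations: `k x` is the number of particles at the site `x`. -/
abbrev Config (d N : ℕ) : Type := Torus d N → ℕ

/-- The rescaled configuration `η(x) = χ k(x)`, in which each particle has size `χ`.
For `χ > 0` this identifies `Config d N` with the state space `(χ ℕ)^(Torus d N)`. -/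
noncomputable def rescale {d N : ℕ} (χ : ℝ) (k : Config d N) : Torus d N → ℝ :=
  fun x => χ * (k x : ℝ)

/-- Nearest neighbours on the discrete torus. -/
def Neighbour {d N : ℕ} (x y : Torus d N) : Prop :=
  ∃ i : Fin d, y = x + Pi.single i 1 ∨ x = y + Pi.single i 1

/-- The configuration obtained from `k` by moving one particle from `x` to `y`
(only used with a positive rate when there is a particle at `x`). -/
def jump {d N : ℕ} (k : Config d N) (x y : Torus d N) : Config d N :=
  k - Pi.single x 1 + Pi.single y 1

open Classical in
/-- The generator `N² L_N` of the rescaled zero-range process,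
`L_N F(η) = ½ ∑_{x ∼ y} (η(x)^α / χ) (F(η^{x,y}) - F(η))`, the sum running over ordered pairs of
neighbouring sites, as an operator on functions of the particle configuration `k = η / χ`. -/
noncomputable def generator {d N : ℕ} [NeZero N] (α χ : ℝ) (F : Config d N → ℝ) :
    Config d N → ℝ :=
  fun k => (N : ℝ) ^ 2 * ((1 / 2) * ∑ x : Torus d N, ∑ y ∈ Finset.univ.filter (Neighbour x),
    (rescale χ k x) ^ α / χ * (F (jump k x y) - F k))

/-- The Markov semigroup `exp (t N² L_N)`, as the exponential series. The dynamics conserves the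
number of particles, so that the generator acts on functions on the finite set of configurations
with a given number of particles and the series converges absolutely at every configuration. -/
noncomputable def semigroup {d N : ℕ} [NeZero N] (α χ t : ℝ) (F : Config d N → ℝ) :
    Config d N → ℝ :=
  fun k => ∑' n : ℕ, t ^ n / (n ! : ℝ) * ((generator α χ)^[n] F) k

/-- The weight `u^(α j) / (j!)^α` of `j` particles at a site. -/
noncomputable def siteWeight (α u : ℝ) (j : ℕ) : ℝ :=
  u ^ (α * (j : ℝ)) / (j ! : ℝ) ^ α

/-- The normalisation constant `Z_α(u) = ∑_j u^(α j) / (j!)^α`. -/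
noncomputable def partitionFunction (α u : ℝ) : ℝ :=
  ∑' j : ℕ, siteWeight α u j

/-- The equilibrium distribution `Π^N_a`, as a measure on particle configurations. -/
noncomputable def equilibrium (d N : ℕ) [NeZero N] (α χ a : ℝ) : Measure (Config d N) :=
  Measure.sum fun k : Config d N =>
    ENNReal.ofReal (∏ x : Torus d N, siteWeight α (a / χ) (k x) / partitionFunction α (a / χ)) •
      Measure.dirac k

/-- The information generated by the process `K` up to time `s`. -/
abbrev history {d N : ℕ} {Ω : Type*} (K : ℝ → Ω → Config d N) (s : ℝ) : MeasurableSpace Ω :=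
  ⨆ r ∈ Set.Icc (0 : ℝ) s, MeasurableSpace.comap (K r) inferInstance

/-- `K` (restricted to nonnegative times) is the process of particle numbers of a rescaled
zero-range process: a Markov jump process with generator `N² L_N`, with càdlàg paths for the
discrete topology of the state space. The rescaled process itself is
`η_t(x) = χ K_t(x) = rescale χ (K t ω) x`. -/
structure IsRescaledZeroRangeProcess {d N : ℕ} [NeZero N] {Ω : Type*} [MeasurableSpace Ω]
    (α χ : ℝ) (P : Measure Ω) (K : ℝ → Ω → Config d N) : Prop where
  measurable : ∀ t, 0 ≤ t → Measurable (K t)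
  right_continuous : ∀ᵐ ω ∂P, ∀ t, 0 ≤ t → ∀ᶠ s in 𝓝[>] t, K s ω = K t ω
  left_limits : ∀ᵐ ω ∂P, ∀ t, 0 < t → ∃ k : Config d N, ∀ᶠ s in 𝓝[<] t, K s ω = k
  markov : ∀ s t, 0 ≤ s → 0 ≤ t → ∀ F : Config d N → ℝ, (∃ C, ∀ k, |F k| ≤ C) →
    P[fun ω => F (K (s + t) ω) | history K s] =ᵐ[P] fun ω => semigroup α χ t F (K s ω)

/-- The lattice box `B_L(x)`, of side length `2 L + 1` (as long as `2 L + 1 ≤ N`), centred at `x`.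
`ZMod.valMinAbs` is the representative of least absolute value. -/
def box {d N : ℕ} [NeZero N] (L : ℕ) (x : Torus d N) : Finset (Torus d N) :=
  Finset.univ.filter fun y => ∀ i, (y i - x i).valMinAbs.natAbs ≤ L

/-- The local average of `η` over the box of side length `2 ⌊ε N⌋ + 1` centred at `x`. -/
noncomputable def localAverage {d N : ℕ} [NeZero N] (ε : ℝ) (η : Torus d N → ℝ) (x : Torus d N) :
    ℝ :=
  (1 / (2 * (⌊ε * (N : ℝ)⌋₊ : ℝ) + 1) ^ d) * ∑ y ∈ box ⌊ε * (N : ℝ)⌋₊ x, η y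

/-- The replacement error `|η(x)^α - (local average of η at x)^α|`. -/
noncomputable def replacementError {d N : ℕ} [NeZero N] (α ε : ℝ) (η : Torus d N → ℝ)
    (x : Torus d N) : ℝ :=
  |(η x) ^ α - (localAverage ε η x) ^ α|

end ZeroRange

/-! An exponential Chebyshev inequality reduces the claim to exponential moments of `∫ W(K t) dt`,
where `W` is `γ / χ` times the total replacement error and `γ` is as large as desired. Started from
the reversible law, a Feynman-Kac bound controls these moments by an upper bound for the quadratic
form of (generator + `W`) in `L²` of the equilibrium (`measure_additiveFunctional_le`). It remains
to bound this form by `β N^d / χ` (`exists_variational_bound`).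

For the form bound, attach to `F` the Hilbert-space-valued function `H = insertion α χ a n F` on the
torus. The product weights give `‖H x‖² = E[η(x)^α F²]` (`norm_insertion_sq`), and the Dirichlet
form becomes `N² / (4χ)` times the sum of `‖H x - H y‖²` over neighbours
(`sum_weight_mul_generator`). Convexity bounds the replacement error by averages of `|η(x)^α -
η(x+z)^α|` over the box (`replacementError_le`). Multiplied by `F²` and averaged, such a term is
essentially a difference of squared amplitudes, hence at most `‖H x - H (x+z)‖² / (2ρ)` plus `O(ρ)`
times second moments (`sum_weight_mul_abs_sub_le`). A displacement of size at most `εN` costs `d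
(εN)²` times the nearest-neighbour increments, so for small `ε` the factor `N²` of the Dirichlet
form absorbs it. Microscopic and macroscopic displacements are treated alike, with no separate
one-block and two-block estimates.

The remaining `ρ ∑ ‖H x‖²` is closed by the same inequality with the whole torus as box: there the
local average is the global density, which is bounded once the number of particles is capped, and
part of the left side is absorbed (`sum_norm_insertion_sq_le`). The cap, `χ n ≤ M N^d`, makes the
state space finite and is preserved by the dynamics; the excluded initial configurations have
superexponentially small probability (`equilibrium_compl_boundedConfigs_le`). -/

namespace ZeroRange

/-! ### Elementary inequalities for `α`-th powers -/

section RealInequalities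

variable {α : ℝ}

theorem rpow_sub_rpow_le (hα : 1 ≤ α) {p q : ℝ} (hp : 0 ≤ p) (hq : 0 ≤ q) :
    p ^ α - q ^ α ≤ α * p ^ (α - 1) * (p - q) := by
  rcases hp.eq_or_lt with rfl | hp
  · rcases hα.eq_or_lt with rfl | hα
    · simp
    · rw [Real.zero_rpow (by linarith), Real.zero_rpow (by linarith)]
      have := Real.rpow_nonneg hq α
      linarith
  · have h := one_add_mul_self_le_rpow_one_add (s := q / p - 1)
      (by have := div_nonneg hq hp.le; linarith) hα
    rw [add_sub_cancel, Real.div_rpow hq hp.le, le_div_iff₀ (Real.rpow_pos_of_pos hp α)] at h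
    have h2 : p ^ α = p ^ (α - 1) * p := by
      rw [← Real.rpow_add_one hp.ne']; simp
    have h3 : (1 + α * (q / p - 1)) * p ^ α = p ^ α + α * p ^ (α - 1) * (q - p) := by
      rw [h2]; field_simp
    linarith

theorem rpow_sub_one_mul_abs_sub_le (hα : 1 ≤ α) {p q : ℝ} (hp : 0 ≤ p) (hq : 0 ≤ q) :
    p ^ (α - 1) * |p - q| ≤ |p ^ α - q ^ α| := by
  have mul_self : ∀ {r : ℝ}, 0 ≤ r → r ^ α = r ^ (α - 1) * r := fun {r} hr => by
    rw [← Real.rpow_add_one' hr (by linarith)]; simp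
  rcases le_total q p with h | h
  · rw [abs_of_nonneg (sub_nonneg.2 h),
      abs_of_nonneg (sub_nonneg.2 (Real.rpow_le_rpow hq h (by linarith))), mul_self hp, mul_self hq]
    have := Real.rpow_le_rpow hq h (sub_nonneg.2 hα)
    nlinarith
  · rw [abs_of_nonpos (sub_nonpos.2 h),
      abs_of_nonpos (sub_nonpos.2 (Real.rpow_le_rpow hp h (by linarith))), mul_self hp, mul_self hq]
    have := Real.rpow_le_rpow hp h (sub_nonneg.2 hα)
    nlinarith

/-- The `α`-th power of an average is as close to `p ^ α` as the `α`-th powers are on average. -/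
theorem abs_rpow_sub_average_rpow_le (hα : 1 ≤ α) {ι : Type*} {s : Finset ι} (hs : s.Nonempty)
    {p : ℝ} (hp : 0 ≤ p) {b : ι → ℝ} (hb : ∀ i, 0 ≤ b i) :
    |p ^ α - ((1 / (s.card : ℝ)) * ∑ i ∈ s, b i) ^ α| ≤
      α * ((1 / (s.card : ℝ)) * ∑ i ∈ s, |p ^ α - b i ^ α|) := by
  have hcard : (0 : ℝ) < s.card := by exact_mod_cast hs.card_pos
  have average : ∀ f : ι → ℝ, (1 / (s.card : ℝ)) * ∑ i ∈ s, f i = ∑ i ∈ s, (1 / (s.card : ℝ)) * f i :=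
    fun f => Finset.mul_sum _ _ _
  have average_const : ∀ c : ℝ, (1 / (s.card : ℝ)) * ∑ _i ∈ s, c = c := fun c => by
    rw [Finset.sum_const, nsmul_eq_mul]; field_simp
  have hinv : 0 ≤ 1 / (s.card : ℝ) := by positivity
  set m : ℝ := (1 / (s.card : ℝ)) * ∑ i ∈ s, b i with hm
  have hm0 : 0 ≤ m := mul_nonneg hinv (Finset.sum_nonneg fun i _ => hb i)
  have habs : 0 ≤ (1 / (s.card : ℝ)) * ∑ i ∈ s, |p ^ α - b i ^ α| :=
    mul_nonneg hinv (Finset.sum_nonneg fun i _ => abs_nonneg _)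
  rw [abs_le']
  constructor
  -- The tangent bound at `p` is affine in `m`, so it can be averaged over the `b i`; the opposite
  -- sign is Jensen's inequality.
  · calc p ^ α - m ^ α ≤ α * p ^ (α - 1) * (p - m) := rpow_sub_rpow_le hα hp hm0
      _ = α * ((1 / (s.card : ℝ)) * ∑ i ∈ s, p ^ (α - 1) * (p - b i)) := by
        rw [← Finset.mul_sum, Finset.sum_sub_distrib, mul_left_comm (1 / (s.card : ℝ)),
          mul_sub (1 / (s.card : ℝ)), average_const, ← hm, mul_assoc]
      _ ≤ _ := by
        gcongr with i
        exact (mul_le_mul_of_nonneg_left (le_abs_self _) (Real.rpow_nonneg hp _)).trans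
          (rpow_sub_one_mul_abs_sub_le hα hp (hb i))
  · have jensen : m ^ α ≤ (1 / (s.card : ℝ)) * ∑ i ∈ s, b i ^ α := by
      rw [hm, average, average]
      exact Real.rpow_arith_mean_le_arith_mean_rpow s _ b (fun _ _ => hinv)
        (by rw [Finset.sum_const, nsmul_eq_mul]; field_simp) (fun i _ => hb i) hα
    calc -(p ^ α - m ^ α) ≤ (1 / (s.card : ℝ)) * ∑ i ∈ s, b i ^ α - p ^ α := by linarith
      _ = (1 / (s.card : ℝ)) * ∑ i ∈ s, (b i ^ α - p ^ α) := by
        rw [Finset.sum_sub_distrib, mul_sub, average_const]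
      _ ≤ (1 / (s.card : ℝ)) * ∑ i ∈ s, |p ^ α - b i ^ α| := by
        gcongr with i
        rw [abs_sub_comm]; exact le_abs_self _
      _ ≤ _ := le_mul_of_one_le_left habs hα

/-- The projection of the real line onto `[-1, 1]`. -/
noncomputable def clamp (s : ℝ) : ℝ := max (-1) (min 1 s)

theorem abs_clamp_le (s : ℝ) : |clamp s| ≤ 1 :=
  abs_le.2 ⟨le_max_left _ _, max_le (by norm_num) (min_le_left _ _)⟩

theorem clamp_sub_clamp_le {s t : ℝ} (h : s ≤ t) : clamp t - clamp s ≤ t - s := by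
  unfold clamp
  rcases max_cases (-1) (min 1 s) with h1 | h1 <;> rcases max_cases (-1) (min 1 t) with h2 | h2 <;>
  rcases min_cases 1 s with h3 | h3 <;> rcases min_cases 1 t with h4 | h4 <;> linarith

theorem clamp_of_one_le {s : ℝ} (h : 1 ≤ s) : clamp s = 1 := by
  rw [clamp, min_eq_left h]; norm_num

theorem clamp_of_le_neg_one {s : ℝ} (h : s ≤ -1) : clamp s = -1 := by
  rw [clamp, max_eq_left ((min_le_right _ _).trans h)]

theorem clamp_nonneg {s : ℝ} (h : 0 ≤ s) : 0 ≤ clamp s :=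
  le_max_of_le_right (le_min zero_le_one h)

theorem clamp_nonpos {s : ℝ} (h : s ≤ 0) : clamp s ≤ 0 :=
  max_le (by norm_num) ((min_le_right _ _).trans h)

theorem rpow_sub_one_le (hα : 1 ≤ α) {p : ℝ} (hp : 0 ≤ p) : p ^ (α - 1) ≤ 1 + p ^ α := by
  rcases le_total p 1 with h | h
  · have := Real.rpow_le_one hp h (sub_nonneg.2 hα)
    have := Real.rpow_nonneg hp α
    linarith
  · have := Real.rpow_le_rpow_of_exponent_le h (show α - 1 ≤ α by linarith)
    linarith

/-- The clamp is a Lipschitz substitute for the sign of `p - q`: exact when `|p - q| ≥ κ`, and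
otherwise the tangent bound makes the whole difference `O(κ)`. The Lipschitz property is needed
because moving one particle changes the argument. -/
theorem abs_rpow_sub_rpow_le_clamp (hα : 1 ≤ α) {κ : ℝ} (hκ : 0 < κ) {p q : ℝ}
    (hp : 0 ≤ p) (hq : 0 ≤ q) :
    |p ^ α - q ^ α| ≤ (p ^ α - q ^ α) * clamp ((p - q) / κ) + α * κ * (1 + p ^ α + q ^ α) := by
  have hpα := Real.rpow_nonneg hp α
  have hqα := Real.rpow_nonneg hq α
  have herr : 0 ≤ α * κ * (1 + p ^ α + q ^ α) := by positivity
  rcases le_total q p with h | h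
  · have hle := Real.rpow_le_rpow hq h (show 0 ≤ α by linarith)
    rw [abs_of_nonneg (sub_nonneg.2 hle)]
    rcases le_total κ (p - q) with h1 | h1
    · rw [clamp_of_one_le ((one_le_div hκ).2 h1)]; linarith
    · have h2 := mul_nonneg (sub_nonneg.2 hle) (clamp_nonneg (div_nonneg (sub_nonneg.2 h) hκ.le))
      have h3 : α * p ^ (α - 1) * (p - q) ≤ α * κ * (1 + p ^ α + q ^ α) :=
        calc α * p ^ (α - 1) * (p - q) ≤ α * (1 + p ^ α) * κ := by
              gcongr
              exact rpow_sub_one_le hα hp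
          _ ≤ _ := by nlinarith [mul_nonneg (mul_nonneg (show 0 ≤ α by linarith) hκ.le) hqα]
      linarith [rpow_sub_rpow_le hα hp hq]
  · have hle := Real.rpow_le_rpow hp h (show 0 ≤ α by linarith)
    rw [abs_of_nonpos (sub_nonpos.2 hle)]
    rcases le_total κ (q - p) with h1 | h1
    · rw [clamp_of_le_neg_one (by rw [div_le_iff₀ hκ]; linarith)]; linarith
    · have h2 := mul_nonneg_of_nonpos_of_nonpos (sub_nonpos.2 hle)
        (clamp_nonpos (div_nonpos_of_nonpos_of_nonneg (sub_nonpos.2 h) hκ.le))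
      have h3 : α * q ^ (α - 1) * (q - p) ≤ α * κ * (1 + p ^ α + q ^ α) :=
        calc α * q ^ (α - 1) * (q - p) ≤ α * (1 + q ^ α) * κ := by
              gcongr
              exact rpow_sub_one_le hα hq
          _ ≤ _ := by nlinarith [mul_nonneg (mul_nonneg (show 0 ≤ α by linarith) hκ.le) hpα]
      linarith [rpow_sub_rpow_le hα hq hp]

end RealInequalities

/-! ### Increments along displacements of a group -/

section Displacement

/-- The sum over the torus of the squared increments along the displacement `z`. -/
noncomputable def squaredIncrement {G E : Type*} [AddCommGroup G] [Fintype G]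
    [SeminormedAddCommGroup E] (H : G → E) (z : G) : ℝ :=
  ∑ x, ‖H x - H (x + z)‖ ^ 2

variable {G E : Type*} [AddCommGroup G] [Fintype G] [SeminormedAddCommGroup E] (H : G → E)

theorem squaredIncrement_nonneg (z : G) : 0 ≤ squaredIncrement H z :=
  Finset.sum_nonneg fun _ _ => by positivity

theorem squaredIncrement_neg (z : G) : squaredIncrement H (-z) = squaredIncrement H z := by
  unfold squaredIncrement
  rw [← Equiv.sum_comp (Equiv.addRight z)]
  refine Finset.sum_congr rfl fun x _ => ?_
  simp only [Equiv.coe_addRight, add_neg_cancel_right]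
  rw [norm_sub_rev]

/-- Telescope along the path of partial sums, apply Cauchy-Schwarz, and use translation invariance
of the sum over the group. -/
theorem squaredIncrement_sum_le (m : ℕ) (v : ℕ → G) :
    squaredIncrement H (∑ j ∈ Finset.range m, v j) ≤
      m * ∑ j ∈ Finset.range m, squaredIncrement H (v j) := by
  have telescope : ∀ x, H x - H (x + ∑ j ∈ Finset.range m, v j) =
      ∑ j ∈ Finset.range m, (H (x + ∑ i ∈ Finset.range j, v i) -
        H (x + ∑ i ∈ Finset.range j, v i + v j)) := by
    intro x
    induction m with
    | zero => simp
    | succ m ih =>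
      rw [Finset.sum_range_succ (n := m), Finset.sum_range_succ (n := m), ← ih, add_assoc]; abel
  calc squaredIncrement H (∑ j ∈ Finset.range m, v j)
      ≤ ∑ x, m * ∑ j ∈ Finset.range m, ‖H (x + ∑ i ∈ Finset.range j, v i) -
        H (x + ∑ i ∈ Finset.range j, v i + v j)‖ ^ 2 := by
        refine Finset.sum_le_sum fun x _ => ?_
        rw [telescope]
        refine (pow_le_pow_left₀ (norm_nonneg _) (norm_sum_le _ _) 2).trans ?_
        simpa using sq_sum_le_card_mul_sum_sq (s := Finset.range m)
          (f := fun j => ‖H (x + ∑ i ∈ Finset.range j, v i) -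
            H (x + ∑ i ∈ Finset.range j, v i + v j)‖)
    _ = m * ∑ j ∈ Finset.range m, squaredIncrement H (v j) := by
        rw [← Finset.mul_sum, Finset.sum_comm]
        congr 1
        refine Finset.sum_congr rfl fun j _ => ?_
        exact Equiv.sum_comp (Equiv.addRight (∑ i ∈ Finset.range j, v i))
          (fun x => ‖H x - H (x + v j)‖ ^ 2)

theorem squaredIncrement_nsmul_le (m : ℕ) (z : G) :
    squaredIncrement H (m • z) ≤ (m : ℝ) ^ 2 * squaredIncrement H z := by
  have h := squaredIncrement_sum_le H m (fun _ => z)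
  simp only [Finset.sum_const, Finset.card_range, nsmul_eq_mul] at h
  rw [← nsmul_eq_mul] at h
  calc _ ≤ _ := by simpa using h
    _ = _ := by ring

theorem squaredIncrement_zsmul_le (m : ℤ) (z : G) :
    squaredIncrement H (m • z) ≤ (m.natAbs : ℝ) ^ 2 * squaredIncrement H z := by
  rcases Int.natAbs_eq m with h | h
  · conv_lhs => rw [h, natCast_zsmul]
    exact squaredIncrement_nsmul_le H _ z
  · conv_lhs => rw [h, neg_smul, natCast_zsmul, squaredIncrement_neg]
    exact squaredIncrement_nsmul_le H _ z

/-- Walk along the coordinate axes one after the other: Cauchy-Schwarz over the `d` directions gives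
`d`, and over the at most `L` unit steps in each gives `L ^ 2`. -/
theorem squaredIncrement_torus_le {d N : ℕ} [NeZero N] (H : Torus d N → E) (L : ℕ)
    (z : Torus d N) (hz : ∀ i, (z i).valMinAbs.natAbs ≤ L) :
    squaredIncrement H z ≤
      d * (L : ℝ) ^ 2 * ∑ i : Fin d, squaredIncrement H (Pi.single i (1 : ZMod N)) := by
  have hsum : z = ∑ j ∈ Finset.range d, (fun j => if h : j < d then
      (z ⟨j, h⟩).valMinAbs • (Pi.single ⟨j, h⟩ 1 : Torus d N) else 0) j := by
    rw [Finset.sum_range]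
    ext i
    simp only [Fin.is_lt, dite_true, Finset.sum_apply, Pi.smul_apply, Fin.eta]
    rw [Finset.sum_eq_single i]
    · simp
    · intro j _ hj
      simp [hj.symm]
    · simp
  conv_lhs => rw [hsum]
  refine (squaredIncrement_sum_le H d _).trans ?_
  rw [mul_assoc (d : ℝ), Finset.mul_sum (a := (L : ℝ) ^ 2), Finset.sum_range]
  refine mul_le_mul_of_nonneg_left (Finset.sum_le_sum fun i _ => ?_) (Nat.cast_nonneg (α := ℝ) d)
  simp only [Fin.is_lt, dite_true, Fin.eta]
  refine (squaredIncrement_zsmul_le H _ _).trans ?_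
  have hle : ((z i).valMinAbs.natAbs : ℝ) ≤ L := by exact_mod_cast hz i
  exact mul_le_mul_of_nonneg_right (pow_le_pow_left₀ (Nat.cast_nonneg _) hle 2)
    (squaredIncrement_nonneg _ _)

end Displacement

/-! ### Single-site weights and the partition function -/

section SiteWeight

variable {α u : ℝ}

theorem siteWeight_eq_rpow (α : ℝ) (hu : 0 < u) (j : ℕ) :
    siteWeight α u j = (u ^ j / (j ! : ℝ)) ^ α := by
  rw [siteWeight, Real.div_rpow (by positivity) (by positivity), mul_comm, Real.rpow_mul hu.le,
    Real.rpow_natCast]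

theorem siteWeight_pos (α : ℝ) (hu : 0 < u) (j : ℕ) : 0 < siteWeight α u j := by
  rw [siteWeight_eq_rpow α hu]; positivity

theorem siteWeight_succ_mul (α : ℝ) (hu : 0 < u) (j : ℕ) :
    siteWeight α u (j + 1) * ((j : ℝ) + 1) ^ α = u ^ α * siteWeight α u j := by
  rw [siteWeight_eq_rpow α hu, siteWeight_eq_rpow α hu, ← Real.mul_rpow (by positivity) (by positivity),
    ← Real.mul_rpow hu.le (by positivity), Nat.factorial_succ]
  congr 1
  push_cast
  rw [pow_succ]
  field_simp

/-- Each `u ^ j / j!` is at most `exp u`, so `α - 1` of the `α` powers can be replaced by `exp u`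
before summing the exponential series. -/
theorem sum_siteWeight_le (hα : 1 ≤ α) (hu : 0 < u) (s : Finset ℕ) :
    ∑ j ∈ s, siteWeight α u j ≤ Real.exp (α * u) := by
  have hsum : ∀ t : Finset ℕ, ∑ j ∈ t, u ^ j / (j ! : ℝ) ≤ Real.exp u := fun t => by
    rw [Real.exp_eq_exp_ℝ, NormedSpace.exp_eq_tsum_div]
    exact (Real.summable_pow_div_factorial u).sum_le_tsum t (fun j _ => by positivity)
  calc ∑ j ∈ s, siteWeight α u j
      ≤ ∑ j ∈ s, Real.exp u ^ (α - 1) * (u ^ j / (j ! : ℝ)) := by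
        refine Finset.sum_le_sum fun j _ => ?_
        have hpos : 0 < u ^ j / (j ! : ℝ) := by positivity
        rw [siteWeight_eq_rpow α hu]
        calc (u ^ j / (j ! : ℝ)) ^ α = (u ^ j / (j ! : ℝ)) ^ (α - 1) * (u ^ j / (j ! : ℝ)) := by
              rw [← Real.rpow_add_one hpos.ne']; simp
          _ ≤ _ := by
              gcongr
              simpa using hsum {j}
    _ ≤ Real.exp u ^ (α - 1) * Real.exp u := by
        rw [← Finset.mul_sum]; gcongr; exact hsum s
    _ = Real.exp (α * u) := by
        rw [← Real.rpow_add_one (Real.exp_pos u).ne', ← Real.exp_mul]; congr 1; ring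

theorem summable_siteWeight (hα : 1 ≤ α) (hu : 0 < u) : Summable (siteWeight α u) :=
  summable_of_sum_le (fun j => (siteWeight_pos α hu j).le) (sum_siteWeight_le hα hu)

theorem one_le_partitionFunction (hα : 1 ≤ α) (hu : 0 < u) : 1 ≤ partitionFunction α u := by
  have h := (summable_siteWeight hα hu).sum_le_tsum {0} (fun j _ => (siteWeight_pos α hu j).le)
  rw [partitionFunction]
  simpa [siteWeight] using h

end SiteWeight

/-! ### Configurations, their weights and the particle-removal identity -/

section Configurations

variable {d N : ℕ}

theorem sub_single_add_single {k : Config d N} {x : Torus d N} (hx : k x ≠ 0) :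
    k - Pi.single x 1 + Pi.single x 1 = k := by
  ext y
  rcases eq_or_ne y x with rfl | h
  · simp; omega
  · simp [h]

theorem jump_add_single (k : Config d N) (x y : Torus d N) :
    jump (k + Pi.single x 1) x y = k + Pi.single y 1 := by
  rw [jump, add_tsub_cancel_right]

theorem rescale_nonneg {χ : ℝ} (hχ : 0 < χ) (k : Config d N) (x : Torus d N) :
    0 ≤ rescale χ k x := by
  unfold rescale; positivity

theorem Neighbour.symm {x y : Torus d N} (h : Neighbour x y) : Neighbour y x := by
  obtain ⟨i, h | h⟩ := h
  exacts [⟨i, Or.inr h⟩, ⟨i, Or.inl h⟩]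

variable [NeZero N]

/-- The equilibrium probability of a configuration. -/
noncomputable def weight (α u : ℝ) (k : Config d N) : ℝ :=
  ∏ x, siteWeight α u (k x) / partitionFunction α u

theorem weight_pos {α u : ℝ} (hα : 1 ≤ α) (hu : 0 < u) (k : Config d N) : 0 < weight α u k :=
  Finset.prod_pos fun _ _ => div_pos (siteWeight_pos α hu _)
    (zero_lt_one.trans_le (one_le_partitionFunction hα hu))

theorem weight_add_single_mul (α : ℝ) {u : ℝ} (hu : 0 < u) (k : Config d N) (x : Torus d N) :
    weight α u (k + Pi.single x 1) * ((k x : ℝ) + 1) ^ α = u ^ α * weight α u k := by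
  unfold weight
  rw [← Finset.mul_prod_erase _ _ (Finset.mem_univ x),
    ← Finset.mul_prod_erase (s := Finset.univ) (a := x) _ (Finset.mem_univ x)]
  have herase : ∏ y ∈ Finset.univ.erase x,
      siteWeight α u ((k + Pi.single x 1 : Config d N) y) / partitionFunction α u =
      ∏ y ∈ Finset.univ.erase x, siteWeight α u (k y) / partitionFunction α u :=
    Finset.prod_congr rfl fun y hy => by simp [Finset.ne_of_mem_erase hy]
  rw [herase]
  simp only [Pi.add_apply, Pi.single_eq_same]
  have h := siteWeight_succ_mul α hu (k x)
  calc _ = (siteWeight α u (k x + 1) * ((k x : ℝ) + 1) ^ α) / partitionFunction α u *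
        ∏ y ∈ Finset.univ.erase x, siteWeight α u (k y) / partitionFunction α u := by ring
    _ = _ := by rw [h]; ring

/-- The configurations with at most `n` particles. -/
noncomputable def boundedConfigs (d N n : ℕ) [NeZero N] : Finset (Config d N) :=
  ((Set.finite_Iic (fun _ => n : Config d N)).subset
    (t := {k : Config d N | ∑ x, k x ≤ n}) fun k hk x =>
      (Finset.single_le_sum (f := k) (fun _ _ => Nat.zero_le _) (Finset.mem_univ x)).trans hk).toFinset

theorem mem_boundedConfigs {n : ℕ} {k : Config d N} :
    k ∈ boundedConfigs d N n ↔ ∑ x, k x ≤ n := by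
  simp [boundedConfigs]

theorem sum_add_single (k : Config d N) (x : Torus d N) :
    ∑ y, (k + Pi.single x 1 : Config d N) y = ∑ y, k y + 1 := by
  simp [Finset.sum_add_distrib]

theorem sum_jump {k : Config d N} {x : Torus d N} (hx : k x ≠ 0) (y : Torus d N) :
    ∑ z, jump k x y z = ∑ z, k z := by
  conv_lhs => rw [← sub_single_add_single hx]
  rw [jump_add_single, sum_add_single, ← sum_add_single _ x, sub_single_add_single hx]

theorem jump_mem_boundedConfigs {n : ℕ} {k : Config d N} {x : Torus d N} (hx : k x ≠ 0)
    (y : Torus d N) : jump k x y ∈ boundedConfigs d N n ↔ k ∈ boundedConfigs d N n := by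
  rw [mem_boundedConfigs, mem_boundedConfigs, sum_jump hx]

/-- Summation by removal of a particle at `x`. -/
theorem sum_weight_mul_rpow {α χ a : ℝ} (hα : 1 ≤ α) (hχ : 0 < χ) (ha : 0 < a) {n : ℕ}
    {G : Config d N → ℝ} (hG : ∀ k ∉ boundedConfigs d N n, G k = 0) (x : Torus d N) :
    ∑ k ∈ boundedConfigs d N n, weight α (a / χ) k * rescale χ k x ^ α * G k =
      a ^ α * ∑ k ∈ boundedConfigs d N n, weight α (a / χ) k * G (k + Pi.single x 1) := by
  -- Inserting a particle leads from at most `n` to at most `n + 1` particles; on the added layer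
  -- `G` vanishes.
  have hsub : boundedConfigs d N n ⊆ boundedConfigs d N (n + 1) := fun k hk => by
    rw [mem_boundedConfigs] at *; omega
  rw [Finset.sum_subset hsub fun k _ hk => by rw [hG k hk, mul_zero], Finset.mul_sum]
  symm
  refine Finset.sum_of_injOn (fun k => k + Pi.single x 1) (add_left_injective _).injOn ?_ ?_ ?_
  · intro k hk
    simp only [Finset.mem_coe, mem_boundedConfigs] at hk ⊢
    rw [sum_add_single]; omega
  · intro k hk hnot
    suffices hx : k x = 0 by
      rw [rescale, hx, Nat.cast_zero, mul_zero, Real.zero_rpow (by linarith)]; ring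
    by_contra hx
    refine hnot ⟨k - Pi.single x 1, ?_, sub_single_add_single hx⟩
    rw [mem_boundedConfigs] at hk
    have h := sum_add_single (k - Pi.single x 1) x
    rw [sub_single_add_single hx] at h
    simp only [Finset.mem_coe, mem_boundedConfigs]
    omega
  · intro k _
    have h := weight_add_single_mul α (div_pos ha hχ) k x
    have hr : rescale χ (k + Pi.single x 1) x ^ α = χ ^ α * ((k x : ℝ) + 1) ^ α := by
      rw [← Real.mul_rpow hχ.le (by positivity), rescale]; simp
    rw [hr]
    rw [Real.div_rpow ha.le hχ.le] at h
    have hχα : χ ^ α ≠ 0 := (Real.rpow_pos_of_pos hχ α).ne'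
    rw [mul_left_comm (weight _ _ _), h]
    field_simp

end Configurations

/-! ### The Dirichlet form as a discrete gradient of the insertion amplitudes -/

section DirichletForm

variable {d N : ℕ} [NeZero N]

/-- The amplitude of `F` after the insertion of a particle at `x`, as a vector whose squared norm
is the second moment of `F` weighted by the jump rate at `x`. -/
noncomputable def insertion (α χ a : ℝ) (n : ℕ) (F : Config d N → ℝ) (x : Torus d N) :
    EuclideanSpace ℝ (boundedConfigs d N n) :=
  WithLp.toLp 2 fun k => √(a ^ α * weight α (a / χ) k.1) * F (k.1 + Pi.single x 1)

variable {α χ a : ℝ} {n : ℕ} {F : Config d N → ℝ}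

theorem inner_insertion (hα : 1 ≤ α) (hχ : 0 < χ) (ha : 0 < a) (x y : Torus d N) :
    inner ℝ (insertion α χ a n F x) (insertion α χ a n F y) =
      a ^ α * ∑ k ∈ boundedConfigs d N n, weight α (a / χ) k *
        (F (k + Pi.single x 1) * F (k + Pi.single y 1)) := by
  rw [Finset.mul_sum, ← Finset.sum_coe_sort, PiLp.inner_apply]
  refine Finset.sum_congr rfl fun k _ => ?_
  simp only [insertion, RCLike.inner_apply, conj_trivial]
  have h := Real.mul_self_sqrt
    (mul_pos (Real.rpow_pos_of_pos ha α) (weight_pos hα (div_pos ha hχ) k.1)).le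
  calc _ = (√(a ^ α * weight α (a / χ) k.1) * √(a ^ α * weight α (a / χ) k.1)) *
        (F (k.1 + Pi.single x 1) * F (k.1 + Pi.single y 1)) := by ring
    _ = _ := by rw [h]; ring

theorem norm_insertion_sq (hα : 1 ≤ α) (hχ : 0 < χ) (ha : 0 < a)
    (hF : ∀ k ∉ boundedConfigs d N n, F k = 0) (x : Torus d N) :
    ‖insertion α χ a n F x‖ ^ 2 =
      ∑ k ∈ boundedConfigs d N n, weight α (a / χ) k * rescale χ k x ^ α * F k ^ 2 := by
  rw [sum_weight_mul_rpow hα hχ ha (G := fun k => F k ^ 2) (fun k hk => by simp [hF k hk]),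
    ← real_inner_self_eq_norm_sq, inner_insertion hα hχ ha]
  simp only [sq]

theorem norm_insertion_sub_sq (hα : 1 ≤ α) (hχ : 0 < χ) (ha : 0 < a) (x y : Torus d N) :
    ‖insertion α χ a n F x - insertion α χ a n F y‖ ^ 2 =
      a ^ α * ∑ k ∈ boundedConfigs d N n, weight α (a / χ) k *
        (F (k + Pi.single x 1) - F (k + Pi.single y 1)) ^ 2 := by
  rw [norm_sub_sq_real, ← real_inner_self_eq_norm_sq, ← real_inner_self_eq_norm_sq,
    inner_insertion hα hχ ha, inner_insertion hα hχ ha, inner_insertion hα hχ ha]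
  simp only [Finset.mul_sum, ← Finset.sum_sub_distrib, ← Finset.sum_add_distrib]
  exact Finset.sum_congr rfl fun k _ => by ring

-- Removing the jumping particle from the sum turns each rate-weighted term into `⟪H x, H y⟫ - ‖H
-- x‖²`; symmetrising over ordered pairs of neighbours completes the square. This is reversibility
-- in integrated form.
open Classical in
theorem sum_weight_mul_generator (hα : 1 ≤ α) (hχ : 0 < χ) (ha : 0 < a)
    (hF : ∀ k ∉ boundedConfigs d N n, F k = 0) :
    ∑ k ∈ boundedConfigs d N n, weight α (a / χ) k * (F k * generator α χ F k) =
      -((N : ℝ) ^ 2 / (4 * χ)) * ∑ x : Torus d N, ∑ y ∈ Finset.univ.filter (Neighbour x),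
        ‖insertion α χ a n F x - insertion α χ a n F y‖ ^ 2 := by
  set H := insertion α χ a n F with hH
  have hedge : ∀ x y : Torus d N, ∑ k ∈ boundedConfigs d N n, weight α (a / χ) k *
      (F k * (rescale χ k x ^ α / χ * (F (jump k x y) - F k))) =
      (1 / χ) * (inner ℝ (H x) (H y) - inner ℝ (H x) (H x)) := by
    intro x y
    have h := sum_weight_mul_rpow hα hχ ha (n := n) (G := fun k => F k * (F (jump k x y) - F k))
      (fun k hk => by simp [hF k hk]) x
    rw [hH, inner_insertion hα hχ ha, inner_insertion hα hχ ha, ← mul_sub,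
      ← Finset.sum_sub_distrib]
    calc _ = (1 / χ) * ∑ k ∈ boundedConfigs d N n, weight α (a / χ) k * rescale χ k x ^ α *
          (F k * (F (jump k x y) - F k)) := by
          rw [Finset.mul_sum]; exact Finset.sum_congr rfl fun k _ => by ring
      _ = _ := by
          rw [h]; simp only [jump_add_single]
          congr 2
          exact Finset.sum_congr rfl fun k _ => by ring
  have hsymm : ∀ f : Torus d N → Torus d N → ℝ,
      ∑ x, ∑ y ∈ Finset.univ.filter (Neighbour x), f x y =
      ∑ x, ∑ y ∈ Finset.univ.filter (Neighbour x), f y x := by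
    intro f
    refine Finset.sum_comm' fun x y => ?_
    simp only [Finset.mem_univ, Finset.mem_filter, true_and, and_true]
    exact ⟨Neighbour.symm, Neighbour.symm⟩
  have hleft : ∑ k ∈ boundedConfigs d N n, weight α (a / χ) k * (F k * generator α χ F k) =
      (N : ℝ) ^ 2 / (2 * χ) * ∑ x : Torus d N, ∑ y ∈ Finset.univ.filter (Neighbour x),
        (inner ℝ (H x) (H y) - inner ℝ (H x) (H x)) := by
    calc _ = ∑ k ∈ boundedConfigs d N n, (N : ℝ) ^ 2 / 2 *
          ∑ x : Torus d N, ∑ y ∈ Finset.univ.filter (Neighbour x), weight α (a / χ) k *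
          (F k * (rescale χ k x ^ α / χ * (F (jump k x y) - F k))) := by
          refine Finset.sum_congr rfl fun k _ => ?_
          simp only [generator, ← Finset.mul_sum]
          ring
      _ = (N : ℝ) ^ 2 / 2 * ∑ x : Torus d N, ∑ y ∈ Finset.univ.filter (Neighbour x),
          (1 / χ) * (inner ℝ (H x) (H y) - inner ℝ (H x) (H x)) := by
          rw [← Finset.mul_sum, Finset.sum_comm]
          congr 1
          refine Finset.sum_congr rfl fun x _ => ?_
          rw [Finset.sum_comm]
          exact Finset.sum_congr rfl fun y _ => hedge x y
      _ = _ := by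
          simp only [← Finset.mul_sum]; field_simp
  have hdouble : ∑ x : Torus d N, ∑ y ∈ Finset.univ.filter (Neighbour x), ‖H x - H y‖ ^ 2 =
      -2 * ∑ x : Torus d N, ∑ y ∈ Finset.univ.filter (Neighbour x),
        (inner ℝ (H x) (H y) - inner ℝ (H x) (H x)) := by
    have h1 := hsymm fun x y => inner ℝ (H x) (H y) - inner ℝ (H x) (H x)
    rw [neg_mul, two_mul]
    nth_rewrite 2 [h1]
    rw [← Finset.sum_add_distrib, ← Finset.sum_neg_distrib]
    refine Finset.sum_congr rfl fun x _ => ?_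
    rw [← Finset.sum_add_distrib, ← Finset.sum_neg_distrib]
    refine Finset.sum_congr rfl fun y _ => ?_
    rw [norm_sub_sq_real, real_inner_self_eq_norm_sq, real_inner_self_eq_norm_sq,
      real_inner_comm (H x) (H y)]
    ring
  rw [hleft, hdouble]
  field_simp
  ring

/-- Each coordinate direction separately is bounded by the full neighbour sum. Averaging over
directions loses a factor `d`, but does not require distinct directions to lead to distinct
neighbours. -/
theorem sum_weight_mul_generator_le (hd : 1 ≤ d) (hα : 1 ≤ α) (hχ : 0 < χ) (ha : 0 < a)
    (hF : ∀ k ∉ boundedConfigs d N n, F k = 0) :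
    ∑ k ∈ boundedConfigs d N n, weight α (a / χ) k * (F k * generator α χ F k) ≤
      -((N : ℝ) ^ 2 / (4 * d * χ)) *
        ∑ i : Fin d, squaredIncrement (insertion α χ a n F) (Pi.single i (1 : ZMod N)) := by
  classical
  have hd' : (0 : ℝ) < d := by exact_mod_cast hd
  rw [sum_weight_mul_generator hα hχ ha hF]
  set H := insertion α χ a n F
  have hi : ∀ i : Fin d, squaredIncrement H (Pi.single i (1 : ZMod N)) ≤
      ∑ x : Torus d N, ∑ y ∈ Finset.univ.filter (Neighbour x), ‖H x - H y‖ ^ 2 := fun i =>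
    Finset.sum_le_sum fun x _ =>
      Finset.single_le_sum (f := fun y => ‖H x - H y‖ ^ 2) (fun _ _ => by positivity)
        (Finset.mem_filter.2 ⟨Finset.mem_univ (x + Pi.single i 1), i, Or.inl rfl⟩)
  have hsum := Finset.sum_le_sum fun i (_ : i ∈ Finset.univ) => hi i
  rw [Finset.sum_const, Finset.card_univ, Fintype.card_fin, nsmul_eq_mul] at hsum
  rw [neg_mul, neg_mul, neg_le_neg_iff]
  calc _ ≤ (N : ℝ) ^ 2 / (4 * d * χ) * (d * ∑ x : Torus d N,
        ∑ y ∈ Finset.univ.filter (Neighbour x), ‖H x - H y‖ ^ 2) := by gcongr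
    _ = _ := by field_simp

/-- With the clamp `c` in place of the sign, particle removal at `x` and at `y` leaves `u² c₁ - v²
c₂ = (u² - v²) c₁ + v² (c₁ - c₂)`, where `u`, `v` are the values of `F` after the two insertions.
Young's inequality with parameter `s` handles the first term; the second is `O(χ / κ)` because the
two insertions shift the argument of the clamp by only `± χ / κ`. -/
theorem sum_weight_mul_abs_sub_le (hα : 1 ≤ α) (hχ : 0 < χ) (ha : 0 < a)
    (hF : ∀ k ∉ boundedConfigs d N n, F k = 0) {s κ : ℝ} (hs : 0 < s) (hκ : 0 < κ)
    (x y : Torus d N) :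
    ∑ k ∈ boundedConfigs d N n, weight α (a / χ) k * F k ^ 2 *
        |rescale χ k x ^ α - rescale χ k y ^ α| ≤
      1 / (2 * s) * ‖insertion α χ a n F x - insertion α χ a n F y‖ ^ 2 +
      s * (‖insertion α χ a n F x‖ ^ 2 + ‖insertion α χ a n F y‖ ^ 2) +
      2 * χ / κ * ‖insertion α χ a n F y‖ ^ 2 +
      α * κ * (∑ k ∈ boundedConfigs d N n, weight α (a / χ) k * F k ^ 2 +
        ‖insertion α χ a n F x‖ ^ 2 + ‖insertion α χ a n F y‖ ^ 2) := by
  have hw : ∀ k : Config d N, 0 < weight α (a / χ) k := weight_pos hα (div_pos ha hχ)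
  have hα0 : 0 < α := by linarith
  -- The shifts by `± χ` computed below hold only for distinct sites.
  rcases eq_or_ne x y with rfl | hxy
  · simp only [sub_self, abs_zero, mul_zero, Finset.sum_const_zero]
    have : 0 ≤ ∑ k ∈ boundedConfigs d N n, weight α (a / χ) k * F k ^ 2 :=
      Finset.sum_nonneg fun k _ => mul_nonneg (hw k).le (sq_nonneg _)
    positivity
  set c : Config d N → ℝ := fun k => clamp ((rescale χ k x - rescale χ k y) / κ) with hc
  have hmain : ∑ k ∈ boundedConfigs d N n, weight α (a / χ) k * F k ^ 2 *
      ((rescale χ k x ^ α - rescale χ k y ^ α) * c k) ≤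
      1 / (2 * s) * ‖insertion α χ a n F x - insertion α χ a n F y‖ ^ 2 +
      s * (‖insertion α χ a n F x‖ ^ 2 + ‖insertion α χ a n F y‖ ^ 2) +
      2 * χ / κ * ‖insertion α χ a n F y‖ ^ 2 := by
    have hshift := fun z : Torus d N => sum_weight_mul_rpow hα hχ ha (n := n)
      (G := fun k => F k ^ 2 * c k) (fun k hk => by simp [hF k hk]) z
    have hsq := fun z : Torus d N => sum_weight_mul_rpow hα hχ ha (n := n)
      (G := fun k => F k ^ 2) (fun k hk => by simp [hF k hk]) z
    calc _ = a ^ α * ∑ k ∈ boundedConfigs d N n, weight α (a / χ) k *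
          (F (k + Pi.single x 1) ^ 2 * c (k + Pi.single x 1)) -
          a ^ α * ∑ k ∈ boundedConfigs d N n, weight α (a / χ) k *
          (F (k + Pi.single y 1) ^ 2 * c (k + Pi.single y 1)) := by
          rw [← hshift x, ← hshift y, ← Finset.sum_sub_distrib]
          exact Finset.sum_congr rfl fun k _ => by ring
      _ ≤ _ := by
          rw [norm_insertion_sub_sq hα hχ ha, norm_insertion_sq hα hχ ha hF,
            norm_insertion_sq hα hχ ha hF, hsq x, hsq y]
          have haα := Real.rpow_pos_of_pos ha α
          simp only [← mul_sub, ← mul_add, mul_left_comm _ (a ^ α)]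
          refine mul_le_mul_of_nonneg_left ?_ haα.le
          simp only [Finset.mul_sum, ← Finset.sum_sub_distrib, ← Finset.sum_add_distrib]
          refine Finset.sum_le_sum fun k _ => ?_
          have hcx : |c (k + Pi.single x 1)| ≤ 1 := abs_clamp_le _
          have hcle : c (k + Pi.single x 1) - c (k + Pi.single y 1) ≤ 2 * χ / κ := by
            have hx : (rescale χ (k + Pi.single x 1) x - rescale χ (k + Pi.single x 1) y) =
                rescale χ k x - rescale χ k y + χ := by
              simp [rescale, hxy.symm]; ring
            have hy : (rescale χ (k + Pi.single y 1) x - rescale χ (k + Pi.single y 1) y) =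
                rescale χ k x - rescale χ k y - χ := by
              simp [rescale, hxy]; ring
            simp only [hc, hx, hy]
            refine (clamp_sub_clamp_le ?_).trans (le_of_eq ?_)
            · gcongr; linarith
            · ring
          generalize F (k + Pi.single x 1) = u
          generalize F (k + Pi.single y 1) = v
          generalize c (k + Pi.single x 1) = c₁ at hcx hcle
          generalize c (k + Pi.single y 1) = c₂ at hcle
          have habs : (u ^ 2 - v ^ 2) * c₁ ≤ 1 / (2 * s) * (u - v) ^ 2 + s * (u ^ 2 + v ^ 2) := by
            have h1 : (u ^ 2 - v ^ 2) * c₁ ≤ |u ^ 2 - v ^ 2| := by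
              refine (le_abs_self _).trans ?_
              rw [abs_mul]; exact mul_le_of_le_one_right (abs_nonneg _) hcx
            have h2 : |u ^ 2 - v ^ 2| ≤ 1 / (2 * s) * (u - v) ^ 2 + s / 2 * (u + v) ^ 2 := by
              have hfac : u ^ 2 - v ^ 2 = (u - v) * (u + v) := by ring
              rw [hfac, abs_mul, ← sq_abs (u - v), ← sq_abs (u + v)]
              have h3 := sq_nonneg (|u - v| - s * |u + v|)
              have h4 : 1 / (2 * s) * |u - v| ^ 2 + s / 2 * |u + v| ^ 2 - |u - v| * |u + v| =
                  1 / (2 * s) * (|u - v| - s * |u + v|) ^ 2 := by field_simp; ring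
              have h5 : 0 ≤ 1 / (2 * s) * (|u - v| - s * |u + v|) ^ 2 := by positivity
              linarith
            have h6 : s / 2 * (u + v) ^ 2 ≤ s * (u ^ 2 + v ^ 2) := by
              nlinarith [mul_nonneg hs.le (sq_nonneg (u - v))]
            linarith
          have hv := mul_le_mul_of_nonneg_left hcle (sq_nonneg v)
          have hk := mul_le_mul_of_nonneg_left (show u ^ 2 * c₁ - v ^ 2 * c₂ ≤
            1 / (2 * s) * (u - v) ^ 2 + s * (u ^ 2 + v ^ 2) + 2 * χ / κ * v ^ 2 by linarith)
            (hw k).le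
          calc _ = weight α (a / χ) k * (u ^ 2 * c₁ - v ^ 2 * c₂) := by ring
            _ ≤ _ := hk
            _ = _ := by ring
  have hpoint : ∑ k ∈ boundedConfigs d N n, weight α (a / χ) k * F k ^ 2 *
      |rescale χ k x ^ α - rescale χ k y ^ α| ≤
      ∑ k ∈ boundedConfigs d N n, (weight α (a / χ) k * F k ^ 2 *
        ((rescale χ k x ^ α - rescale χ k y ^ α) * c k) +
        α * κ * (weight α (a / χ) k * F k ^ 2 + weight α (a / χ) k * rescale χ k x ^ α * F k ^ 2 +
          weight α (a / χ) k * rescale χ k y ^ α * F k ^ 2)) := by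
    refine Finset.sum_le_sum fun k _ => ?_
    have h := mul_le_mul_of_nonneg_left (abs_rpow_sub_rpow_le_clamp hα hκ
      (rescale_nonneg hχ k x) (rescale_nonneg hχ k y)) (mul_nonneg (hw k).le (sq_nonneg (F k)))
    calc _ ≤ _ := h
      _ = _ := by ring
  rw [Finset.sum_add_distrib, ← Finset.mul_sum, Finset.sum_add_distrib, Finset.sum_add_distrib,
    ← norm_insertion_sq hα hχ ha hF, ← norm_insertion_sq hα hχ ha hF] at hpoint
  linarith

end DirichletForm

/-! ### Boxes in the torus and reduction to pairwise differences -/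

section Boxes

variable {d N : ℕ} [NeZero N]

theorem card_interval_zmod {L : ℕ} (hL : 2 * L + 1 ≤ N) (c : ZMod N) :
    (Finset.univ.filter fun b : ZMod N => (b - c).valMinAbs.natAbs ≤ L).card = 2 * L + 1 := by
  have hIcc : (Finset.Icc (-(L : ℤ)) L).card = 2 * L + 1 := by
    rw [Int.card_Icc]; omega
  rw [← hIcc]
  refine Finset.card_nbij' (fun b => (b - c).valMinAbs) (fun m => (m : ZMod N) + c) ?_ ?_ ?_ ?_
  · intro b hb
    simp only [Finset.coe_filter, Finset.mem_univ, true_and, Set.mem_ofPred_eq] at hb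
    simp only [Finset.coe_Icc, Set.mem_Icc]
    omega
  · intro m hm
    simp only [Finset.coe_Icc, Set.mem_Icc] at hm
    simp only [Finset.coe_filter, Finset.mem_univ, true_and, Set.mem_ofPred_eq, add_sub_cancel_right]
    rw [(ZMod.valMinAbs_spec (m : ZMod N) m).2 ⟨rfl, by constructor <;> omega⟩]
    omega
  · intro b _
    simp
  · intro m hm
    simp only [Finset.coe_Icc, Set.mem_Icc] at hm
    simp only [add_sub_cancel_right]
    exact (ZMod.valMinAbs_spec (m : ZMod N) m).2 ⟨rfl, by constructor <;> omega⟩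

theorem card_box {L : ℕ} (hL : 2 * L + 1 ≤ N) (x : Torus d N) :
    (box L x).card = (2 * L + 1) ^ d := by
  have h : box L x = Fintype.piFinset fun i =>
      Finset.univ.filter fun b : ZMod N => (b - x i).valMinAbs.natAbs ≤ L := by
    ext y; simp [box]
  rw [h, Fintype.card_piFinset, Finset.prod_congr rfl fun i _ => card_interval_zmod hL (x i)]
  simp

theorem sum_box (L : ℕ) (x : Torus d N) (f : Torus d N → ℝ) :
    ∑ y ∈ box L x, f y = ∑ z ∈ box L (0 : Torus d N), f (x + z) := by
  refine Finset.sum_nbij' (fun y => y - x) (fun z => x + z) ?_ ?_ ?_ ?_ ?_ <;>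
    simp [box]

theorem self_mem_box (L : ℕ) (x : Torus d N) : x ∈ box L x := by
  simp [box]

theorem replacementError_le {α ε : ℝ} (hα : 1 ≤ α) (hε : 2 * ⌊ε * N⌋₊ + 1 ≤ N)
    {η : Torus d N → ℝ} (hη : ∀ x, 0 ≤ η x) (x : Torus d N) :
    replacementError α ε η x ≤ α * ((1 / ((2 * ⌊ε * N⌋₊ + 1) ^ d : ℝ)) *
      ∑ z ∈ box ⌊ε * N⌋₊ (0 : Torus d N), |η x ^ α - η (x + z) ^ α|) := by
  have h := abs_rpow_sub_average_rpow_le hα ⟨x, self_mem_box ⌊ε * N⌋₊ x⟩ (hη x) hη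
  rw [card_box hε, sum_box _ _ fun y => |η x ^ α - η y ^ α|] at h
  push_cast at h
  exact h

theorem card_torus : Fintype.card (Torus d N) = N ^ d := by
  simp [ZMod.card]

end Boxes

/-! ### The energy estimate for the replacement error -/

section VariationalEstimate

variable {d N : ℕ} [NeZero N] {α χ a : ℝ} {n : ℕ} {F : Config d N → ℝ}

/-- Both the Young parameter and the clamp scale are set to `ρ`; then `χ ≤ ρ ^ 2` makes the clamp
error `2χ / ρ` at most `2ρ`. -/
theorem sum_displacement_le (hα : 1 ≤ α) (hχ : 0 < χ) (ha : 0 < a)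
    (hF : ∀ k ∉ boundedConfigs d N n, F k = 0) {ρ : ℝ} (hρ : 0 < ρ) (hχρ : χ ≤ ρ ^ 2)
    {L : ℕ} {z : Torus d N} (hz : z ∈ box L (0 : Torus d N)) :
    ∑ x, ∑ k ∈ boundedConfigs d N n, weight α (a / χ) k * F k ^ 2 *
        |rescale χ k x ^ α - rescale χ k (x + z) ^ α| ≤
      d * (L : ℝ) ^ 2 / (2 * ρ) *
        ∑ i : Fin d, squaredIncrement (insertion α χ a n F) (Pi.single i (1 : ZMod N)) +
      6 * α * ρ * ∑ x, ‖insertion α χ a n F x‖ ^ 2 +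
      α * ρ * ((N : ℝ) ^ d * ∑ k ∈ boundedConfigs d N n, weight α (a / χ) k * F k ^ 2) := by
  set H := insertion α χ a n F
  set A := ∑ x, ‖H x‖ ^ 2 with hA
  set m := ∑ k ∈ boundedConfigs d N n, weight α (a / χ) k * F k ^ 2
  have hA0 : 0 ≤ A := Finset.sum_nonneg fun x _ => by positivity
  have hshift : ∑ x, ‖H (x + z)‖ ^ 2 = A := Equiv.sum_comp (Equiv.addRight z) fun x => ‖H x‖ ^ 2
  have hconst : ∑ _x : Torus d N, m = (N : ℝ) ^ d * m := by
    rw [Finset.sum_const, Finset.card_univ, card_torus, nsmul_eq_mul]; push_cast; rfl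
  have hincr := squaredIncrement_torus_le H L z (by simpa [box] using hz)
  calc _ ≤ ∑ x, (1 / (2 * ρ) * ‖H x - H (x + z)‖ ^ 2 + ρ * (‖H x‖ ^ 2 + ‖H (x + z)‖ ^ 2) +
        2 * χ / ρ * ‖H (x + z)‖ ^ 2 + α * ρ * (m + ‖H x‖ ^ 2 + ‖H (x + z)‖ ^ 2)) :=
        Finset.sum_le_sum fun x _ => sum_weight_mul_abs_sub_le hα hχ ha hF hρ hρ x (x + z)
    _ = 1 / (2 * ρ) * squaredIncrement H z + (2 * ρ + 2 * χ / ρ + 2 * α * ρ) * A +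
        α * ρ * ((N : ℝ) ^ d * m) := by
        simp only [Finset.sum_add_distrib, ← Finset.mul_sum, hshift, hconst, ← hA]
        rw [squaredIncrement]; ring
    _ ≤ _ := by
        have h1 : 2 * χ / ρ ≤ 2 * ρ := by rw [div_le_iff₀ hρ]; nlinarith
        have h2 : 2 * ρ + 2 * χ / ρ + 2 * α * ρ ≤ 6 * α * ρ := by nlinarith
        have h3 := mul_le_mul_of_nonneg_right h2 hA0
        have h4 := mul_le_mul_of_nonneg_left hincr (show 0 ≤ 1 / (2 * ρ) by positivity)
        have h5 : 1 / (2 * ρ) * (d * (L : ℝ) ^ 2 *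
          ∑ i : Fin d, squaredIncrement H (Pi.single i (1 : ZMod N))) =
          d * (L : ℝ) ^ 2 / (2 * ρ) *
          ∑ i : Fin d, squaredIncrement H (Pi.single i (1 : ZMod N)) := by ring
        linarith

theorem sum_average_displacement_le (hα : 1 ≤ α) (hχ : 0 < χ) (ha : 0 < a)
    (hF : ∀ k ∉ boundedConfigs d N n, F k = 0) {ρ : ℝ} (hρ : 0 < ρ) (hχρ : χ ≤ ρ ^ 2) (L : ℕ) :
    ∑ k ∈ boundedConfigs d N n, weight α (a / χ) k * F k ^ 2 *
        ∑ x, (1 / ((box L (0 : Torus d N)).card : ℝ)) * ∑ z ∈ box L (0 : Torus d N),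
          |rescale χ k x ^ α - rescale χ k (x + z) ^ α| ≤
      d * (L : ℝ) ^ 2 / (2 * ρ) *
        ∑ i : Fin d, squaredIncrement (insertion α χ a n F) (Pi.single i (1 : ZMod N)) +
      6 * α * ρ * ∑ x, ‖insertion α χ a n F x‖ ^ 2 +
      α * ρ * ((N : ℝ) ^ d * ∑ k ∈ boundedConfigs d N n, weight α (a / χ) k * F k ^ 2) := by
  have hcard : (0 : ℝ) < (box L (0 : Torus d N)).card := by
    exact_mod_cast Finset.card_pos.2 ⟨0, self_mem_box L 0⟩
  calc _ = (1 / ((box L (0 : Torus d N)).card : ℝ)) * ∑ z ∈ box L (0 : Torus d N),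
        ∑ x, ∑ k ∈ boundedConfigs d N n, weight α (a / χ) k * F k ^ 2 *
        |rescale χ k x ^ α - rescale χ k (x + z) ^ α| := by
        simp only [← Finset.mul_sum]
        simp only [mul_left_comm _ (1 / ((box L (0 : Torus d N)).card : ℝ)), ← Finset.mul_sum]
        congr 1
        simp only [Finset.mul_sum]
        rw [Finset.sum_comm, Finset.sum_congr rfl fun x _ => Finset.sum_comm, Finset.sum_comm]
    _ ≤ _ := by
        rw [one_div, inv_mul_le_iff₀ hcard, ← nsmul_eq_mul]
        exact Finset.sum_le_card_nsmul _ _ _ fun z hz => sum_displacement_le hα hχ ha hF hρ hχρ hz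

/-- Self-bounding argument: compare each `η(x)^α` with the `α`-th power of the global density, which
is at most `M ^ α`. The error is the displacement estimate over the whole torus, and it contains the
left side itself with a coefficient below one. -/
theorem sum_norm_insertion_sq_le (hα : 1 ≤ α) (hχ : 0 < χ) (ha : 0 < a)
    (hF : ∀ k ∉ boundedConfigs d N n, F k = 0) (hχα : χ ≤ (1 / (12 * α ^ 2)) ^ 2)
    {M : ℝ} (hn : χ * n ≤ M * (N : ℝ) ^ d) :
    ∑ x, ‖insertion α χ a n F x‖ ^ 2 ≤
      (2 * M ^ α + 1 + 12 * α ^ 3 * d) *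
        ((N : ℝ) ^ d * ∑ k ∈ boundedConfigs d N n, weight α (a / χ) k * F k ^ 2 +
        (N : ℝ) ^ 2 *
        ∑ i : Fin d, squaredIncrement (insertion α χ a n F) (Pi.single i (1 : ZMod N))) := by
  have hw : ∀ k : Config d N, 0 < weight α (a / χ) k := weight_pos hα (div_pos ha hχ)
  have hα0 : 0 < α := by linarith
  have hN : (0 : ℝ) < N := by exact_mod_cast NeZero.pos N
  have hT : (0 : ℝ) < (N : ℝ) ^ d := by positivity
  have hM : 0 ≤ M := nonneg_of_mul_nonneg_left ((by positivity : 0 ≤ χ * n).trans hn) hT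
  have hMα : 0 ≤ M ^ α := Real.rpow_nonneg hM α
  -- The choice `ρ = 1 / (12 α²)` makes the coefficient `α · 6αρ` of the quantity being bounded
  -- equal to `1 / 2`.
  have hexpand : ∀ T m' B' A' : ℝ, T * M ^ α * m' +
      α * (d * (N : ℝ) ^ 2 / (2 * (1 / (12 * α ^ 2))) * B' +
      6 * α * (1 / (12 * α ^ 2)) * A' + α * (1 / (12 * α ^ 2)) * (T * m')) =
      (M ^ α + 1 / 12) * (T * m') + 6 * α ^ 3 * d * ((N : ℝ) ^ 2 * B') + A' / 2 := by
    intro T m' B' A'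
    generalize M ^ α = c
    field_simp
    ring
  have huniv : box N (0 : Torus d N) = Finset.univ := by
    ext y
    simp only [box, Finset.mem_filter, Finset.mem_univ, true_and, iff_true]
    exact fun i => (ZMod.natAbs_valMinAbs_le _).trans (Nat.div_le_self _ _)
  have h := sum_average_displacement_le hα hχ ha hF
    (show 0 < 1 / (12 * α ^ 2) by positivity) hχα N
  rw [huniv, Finset.card_univ, card_torus] at h
  have hpoint : ∀ k ∈ boundedConfigs d N n, ∀ x : Torus d N, rescale χ k x ^ α ≤ M ^ α +
      α * ((1 / ((N ^ d : ℕ) : ℝ)) * ∑ z, |rescale χ k x ^ α - rescale χ k (x + z) ^ α|) := by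
    intro k hk x
    have h1 := abs_rpow_sub_average_rpow_le hα (s := Finset.univ) ⟨x, Finset.mem_univ x⟩
      (rescale_nonneg hχ k x) (b := fun z => rescale χ k (x + z)) fun z => rescale_nonneg hχ k _
    rw [Finset.card_univ, card_torus] at h1
    have h2 : (1 / ((N ^ d : ℕ) : ℝ)) * ∑ z, rescale χ k (x + z) ≤ M := by
      have hx : ∑ z, rescale χ k (x + z) = ∑ z, rescale χ k z :=
        Equiv.sum_comp (Equiv.addLeft x) (rescale χ k)
      rw [hx]
      simp only [rescale, ← Finset.mul_sum]
      push_cast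
      rw [one_div, inv_mul_le_iff₀ hT, mul_comm _ M]
      refine le_trans ?_ hn
      gcongr
      exact_mod_cast mem_boundedConfigs.1 hk
    have h3 := Real.rpow_le_rpow (mul_nonneg (by positivity)
      (Finset.sum_nonneg fun z _ => rescale_nonneg hχ k (x + z))) h2 hα0.le
    linarith [(le_abs_self _).trans h1]
  set m := ∑ k ∈ boundedConfigs d N n, weight α (a / χ) k * F k ^ 2 with hm
  set B := ∑ i : Fin d, squaredIncrement (insertion α χ a n F) (Pi.single i (1 : ZMod N))
  set A := ∑ x, ‖insertion α χ a n F x‖ ^ 2 with hA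
  have hm0 : 0 ≤ m := Finset.sum_nonneg fun k _ => mul_nonneg (hw k).le (sq_nonneg _)
  have hB0 : 0 ≤ B := Finset.sum_nonneg fun i _ => squaredIncrement_nonneg _ _
  have hle : A ≤ (N : ℝ) ^ d * M ^ α * m + α * ∑ k ∈ boundedConfigs d N n,
      weight α (a / χ) k * F k ^ 2 * ∑ x, (1 / ((N ^ d : ℕ) : ℝ)) *
        ∑ z, |rescale χ k x ^ α - rescale χ k (x + z) ^ α| := by
    have hA' : A = ∑ k ∈ boundedConfigs d N n, weight α (a / χ) k * F k ^ 2 *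
        ∑ x, rescale χ k x ^ α := by
      simp only [hA, norm_insertion_sq hα hχ ha hF, Finset.mul_sum]
      rw [Finset.sum_comm]
      exact Finset.sum_congr rfl fun k _ => Finset.sum_congr rfl fun x _ => by ring
    rw [hA', hm, Finset.mul_sum, Finset.mul_sum, ← Finset.sum_add_distrib]
    refine Finset.sum_le_sum fun k hk => ?_
    have h1 := Finset.sum_le_sum fun x (_ : x ∈ Finset.univ) => hpoint k hk x
    rw [Finset.sum_add_distrib, Finset.sum_const, Finset.card_univ, card_torus, nsmul_eq_mul,
      ← Finset.mul_sum] at h1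
    have h2 := mul_le_mul_of_nonneg_left h1 (mul_nonneg (hw k).le (sq_nonneg (F k)))
    push_cast at h2 ⊢
    linarith
  have hkey := hle.trans (add_le_add_right (mul_le_mul_of_nonneg_left h hα0.le) _)
  rw [hexpand] at hkey
  have hTm : 0 ≤ (N : ℝ) ^ d * m := mul_nonneg hT.le hm0
  have hNB : 0 ≤ (N : ℝ) ^ 2 * B := mul_nonneg (sq_nonneg _) hB0
  have h1 : 0 ≤ M ^ α * ((N : ℝ) ^ 2 * B) := mul_nonneg hMα hNB
  have h2 : 0 ≤ α ^ 3 * d * ((N : ℝ) ^ d * m) := mul_nonneg (by positivity) hTm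
  linarith

/-- The energy estimate: the replacement error is dominated by the Dirichlet form. -/
theorem exists_variational_bound (hd : 1 ≤ d) (hα : 1 ≤ α) (ha : 0 < a) {M γ β : ℝ}
    (hM : 0 ≤ M) (hγ : 0 < γ) (hβ : 0 < β) :
    ∃ ε₀ > (0 : ℝ), ∃ χ₀ > (0 : ℝ), ∀ ε : ℝ, 0 < ε → ε ≤ ε₀ → ∀ χ : ℝ, 0 < χ → χ ≤ χ₀ →
      ∀ (N : ℕ) [NeZero N], 2 * ⌊ε * N⌋₊ + 1 ≤ N → ∀ n : ℕ, χ * n ≤ M * (N : ℝ) ^ d →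
      ∀ F : Config d N → ℝ, (∀ k ∉ boundedConfigs d N n, F k = 0) →
      ∑ k ∈ boundedConfigs d N n, weight α (a / χ) k * (F k * (generator α χ F k +
        γ / χ * ∑ x, replacementError α ε (rescale χ k) x * F k)) ≤
      β * (N : ℝ) ^ d / χ * ∑ k ∈ boundedConfigs d N n, weight α (a / χ) k * F k ^ 2 := by
  have hα0 : 0 < α := by linarith
  have hd0 : (0 : ℝ) < d := by exact_mod_cast hd
  set c : ℝ := 2 * M ^ α + 1 + 12 * α ^ 3 * d with hc
  have hc0 : 0 < c := by have := Real.rpow_nonneg hM α; positivity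
  -- The Dirichlet form offers `1 / (4d)` of `N² B`. One half, `1 / (8d)`, pays for the gradient
  -- part of the second-moment bound, the other half for the displacement; the remaining mass terms
  -- must fit into `β`.
  obtain ⟨ρ, hρ, hρ1, hρ2⟩ : ∃ ρ : ℝ, 0 < ρ ∧ γ * α * (6 * α * c) * ρ ≤ 1 / (8 * d) ∧
      γ * α * (6 * α * c + α) * ρ ≤ β := by
    refine ⟨min (1 / (8 * d) / (γ * α * (6 * α * c))) (β / (γ * α * (6 * α * c + α))),
      by positivity, ?_, ?_⟩
    · rw [mul_comm, ← le_div_iff₀ (by positivity)]; exact min_le_left _ _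
    · rw [mul_comm, ← le_div_iff₀ (by positivity)]; exact min_le_right _ _
  -- Solves `γ α d ε² / (2ρ) = 1 / (8d)` for `ε`; the two bounds on `χ` serve the scales `ρ` and `1
  -- / (12 α²)`.
  refine ⟨√(ρ / (4 * γ * α * d ^ 2)), Real.sqrt_pos.2 (by positivity),
    min (ρ ^ 2) ((1 / (12 * α ^ 2)) ^ 2), by positivity, ?_⟩
  intro ε hε hε₀ χ hχ hχ₀ N _ hN n hn F hF
  have hw : ∀ k : Config d N, 0 < weight α (a / χ) k := weight_pos hα (div_pos ha hχ)
  have hε2 : ε ^ 2 ≤ ρ / (4 * γ * α * d ^ 2) := by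
    rwa [← Real.le_sqrt hε.le (by positivity)]
  have hN0 : (0 : ℝ) < N := by exact_mod_cast NeZero.pos N
  have hA := sum_norm_insertion_sq_le hα hχ ha hF (hχ₀.trans (min_le_right _ _)) hn
  have havg := sum_average_displacement_le hα hχ ha hF hρ (hχ₀.trans (min_le_left _ _)) ⌊ε * N⌋₊
  have hgen := sum_weight_mul_generator_le hd hα hχ ha hF
  set L := ⌊ε * N⌋₊
  have hL : (L : ℝ) ^ 2 ≤ ε ^ 2 * (N : ℝ) ^ 2 := by
    rw [← mul_pow]
    exact pow_le_pow_left₀ (Nat.cast_nonneg _) (Nat.floor_le (by positivity)) 2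
  set m := ∑ k ∈ boundedConfigs d N n, weight α (a / χ) k * F k ^ 2 with hm
  set B := ∑ i : Fin d, squaredIncrement (insertion α χ a n F) (Pi.single i (1 : ZMod N))
  set A := ∑ x, ‖insertion α χ a n F x‖ ^ 2
  have hm0 : 0 ≤ m := Finset.sum_nonneg fun k _ => mul_nonneg (hw k).le (sq_nonneg _)
  have hB0 : 0 ≤ B := Finset.sum_nonneg fun i _ => squaredIncrement_nonneg _ _
  have herr : ∑ k ∈ boundedConfigs d N n, weight α (a / χ) k * F k ^ 2 *
      ∑ x, replacementError α ε (rescale χ k) x ≤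
      α * ((d * (L : ℝ) ^ 2 / (2 * ρ) * B + 6 * α * ρ * A + α * ρ * ((N : ℝ) ^ d * m))) := by
    refine le_trans ?_ (mul_le_mul_of_nonneg_left havg hα0.le)
    rw [Finset.mul_sum]
    refine Finset.sum_le_sum fun k _ => ?_
    rw [mul_left_comm, Finset.mul_sum (a := α)]
    refine mul_le_mul_of_nonneg_left (Finset.sum_le_sum fun x _ => ?_)
      (mul_nonneg (hw k).le (sq_nonneg _))
    rw [card_box hN]
    push_cast
    exact replacementError_le hα hN (rescale_nonneg hχ k) x
  have hb1 : γ * α * (d * (L : ℝ) ^ 2 / (2 * ρ) * B) ≤ 1 / (8 * d) * ((N : ℝ) ^ 2 * B) := by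
    calc γ * α * (d * (L : ℝ) ^ 2 / (2 * ρ) * B)
        ≤ γ * α * (d * (ρ / (4 * γ * α * d ^ 2) * (N : ℝ) ^ 2) / (2 * ρ) * B) := by
          gcongr
          exact hL.trans (by gcongr)
      _ = _ := by field_simp; ring
  have hb2 : γ * α * (6 * α * ρ * A + α * ρ * ((N : ℝ) ^ d * m)) ≤
      1 / (8 * d) * ((N : ℝ) ^ 2 * B) + β * ((N : ℝ) ^ d * m) := by
    calc γ * α * (6 * α * ρ * A + α * ρ * ((N : ℝ) ^ d * m))
        ≤ γ * α * (6 * α * ρ * (c * ((N : ℝ) ^ d * m + (N : ℝ) ^ 2 * B)) +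
          α * ρ * ((N : ℝ) ^ d * m)) := by gcongr
      _ = γ * α * (6 * α * c) * ρ * ((N : ℝ) ^ 2 * B) +
          γ * α * (6 * α * c + α) * ρ * ((N : ℝ) ^ d * m) := by ring
      _ ≤ _ := by gcongr
  calc _ = ∑ k ∈ boundedConfigs d N n, weight α (a / χ) k * (F k * generator α χ F k) +
        γ / χ * ∑ k ∈ boundedConfigs d N n, weight α (a / χ) k * F k ^ 2 *
          ∑ x, replacementError α ε (rescale χ k) x := by
        rw [Finset.mul_sum, ← Finset.sum_add_distrib]
        refine Finset.sum_congr rfl fun k _ => ?_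
        rw [← Finset.sum_mul]; ring
    _ ≤ -((N : ℝ) ^ 2 / (4 * d * χ)) * B + γ / χ * (α * ((d * (L : ℝ) ^ 2 / (2 * ρ) * B +
        6 * α * ρ * A + α * ρ * ((N : ℝ) ^ d * m)))) := by gcongr
    _ = 1 / χ * (-(1 / (8 * d) * ((N : ℝ) ^ 2 * B)) - (1 / (8 * d) * ((N : ℝ) ^ 2 * B)) +
        γ * α * (d * (L : ℝ) ^ 2 / (2 * ρ) * B) +
        γ * α * (6 * α * ρ * A + α * ρ * ((N : ℝ) ^ d * m))) := by field_simp; ring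
    _ ≤ 1 / χ * (β * ((N : ℝ) ^ d * m)) := by
        refine mul_le_mul_of_nonneg_left ?_ (by positivity)
        linarith
    _ = _ := by ring

end VariationalEstimate

/-! ### The semigroup on configurations with a bounded number of particles -/

section Semigroup

variable {d N : ℕ} {α χ : ℝ} {n : ℕ}

theorem rate_eq_zero (hα : 1 ≤ α) {k : Config d N} {x : Torus d N} (hx : k x = 0) :
    rescale χ k x ^ α / χ = 0 := by
  rw [rescale, hx, Nat.cast_zero, mul_zero, Real.zero_rpow (by linarith), zero_div]

variable [NeZero N]

theorem generator_sub (F G : Config d N → ℝ) :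
    generator α χ (F - G) = generator α χ F - generator α χ G := by
  classical
  ext k
  simp only [generator, Pi.sub_apply, ← mul_sub, ← Finset.sum_sub_distrib]
  congr 2
  exact Finset.sum_congr rfl fun x _ => Finset.sum_congr rfl fun y _ => by ring

theorem generator_eq_zero (hα : 1 ≤ α) {F : Config d N → ℝ}
    (hF : ∀ k ∉ boundedConfigs d N n, F k = 0) :
    ∀ k ∉ boundedConfigs d N n, generator α χ F k = 0 := by
  classical
  intro k hk
  rw [generator, Finset.sum_eq_zero, mul_zero, mul_zero]
  intro x _
  refine Finset.sum_eq_zero fun y _ => ?_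
  rcases eq_or_ne (k x) 0 with hx | hx
  · rw [rate_eq_zero hα hx, zero_mul]
  · rw [hF k hk, hF _ fun h => hk ((jump_mem_boundedConfigs hx y).1 h), sub_zero, mul_zero]

/-- Jumps conserve the number of particles, and a jump from an empty site has rate zero. -/
theorem generator_indicator (hα : 1 ≤ α) :
    generator α χ ((boundedConfigs d N n : Set (Config d N)).indicator 1) = 0 := by
  classical
  ext k
  rw [generator, Finset.sum_eq_zero, mul_zero, mul_zero, Pi.zero_apply]
  intro x _
  refine Finset.sum_eq_zero fun y _ => ?_
  rcases eq_or_ne (k x) 0 with hx | hx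
  · rw [rate_eq_zero hα hx, zero_mul]
  · simp only [Set.indicator_apply, Finset.mem_coe, jump_mem_boundedConfigs hx, Pi.one_apply,
      sub_self, mul_zero]

theorem exists_generator_bound (hα : 1 ≤ α) (hχ : 0 < χ) (n : ℕ) :
    ∃ C : ℝ, 0 ≤ C ∧ ∀ (F : Config d N → ℝ) (c : ℝ), (∀ k ∈ boundedConfigs d N n, |F k| ≤ c) →
      ∀ k ∈ boundedConfigs d N n, |generator α χ F k| ≤ C * c := by
  classical
  set r : Config d N → ℝ := fun k => (N : ℝ) ^ 2 * ((1 / 2) * ∑ x : Torus d N,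
    ∑ _y ∈ Finset.univ.filter (Neighbour x), rescale χ k x ^ α / χ * 2) with hr
  have hrate : ∀ (k : Config d N) x, 0 ≤ rescale χ k x ^ α / χ := fun k x =>
    div_nonneg (Real.rpow_nonneg (rescale_nonneg hχ k x) _) hχ.le
  have hr0 : ∀ k, 0 ≤ r k := fun k => mul_nonneg (by positivity) <| mul_nonneg (by norm_num) <|
    Finset.sum_nonneg fun x _ => Finset.sum_nonneg fun y _ => mul_nonneg (hrate k x) (by norm_num)
  refine ⟨∑ k ∈ boundedConfigs d N n, r k, Finset.sum_nonneg fun k _ => hr0 k, ?_⟩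
  intro F c hF k hk
  have hc : 0 ≤ c := (abs_nonneg _).trans (hF k hk)
  calc |generator α χ F k| ≤ (N : ℝ) ^ 2 * ((1 / 2) * ∑ x : Torus d N,
        ∑ y ∈ Finset.univ.filter (Neighbour x),
          |rescale χ k x ^ α / χ * (F (jump k x y) - F k)|) := by
        rw [generator, abs_mul, abs_mul, abs_of_nonneg (by positivity : 0 ≤ (N : ℝ) ^ 2),
          abs_of_nonneg (by norm_num : (0 : ℝ) ≤ 1 / 2)]
        gcongr
        refine (Finset.abs_sum_le_sum_abs _ _).trans (Finset.sum_le_sum fun x _ => ?_)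
        exact Finset.abs_sum_le_sum_abs _ _
    _ ≤ (N : ℝ) ^ 2 * ((1 / 2) * ∑ x : Torus d N,
        ∑ _y ∈ Finset.univ.filter (Neighbour x), rescale χ k x ^ α / χ * 2 * c) := by
        gcongr with x _ y _
        rw [abs_mul, abs_of_nonneg (hrate k x), mul_assoc]
        rcases eq_or_ne (k x) 0 with hx | hx
        · rw [rate_eq_zero hα hx, zero_mul, zero_mul]
        · refine mul_le_mul_of_nonneg_left ?_ (hrate k x)
          have h1 := hF _ ((jump_mem_boundedConfigs hx y).2 hk)
          have h2 := abs_sub (F (jump k x y)) (F k)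
          linarith [hF k hk]
    _ = r k * c := by simp only [hr, ← Finset.sum_mul]; ring
    _ ≤ _ := mul_le_mul_of_nonneg_right
        (Finset.single_le_sum (f := r) (fun k _ => hr0 k) hk) hc

theorem semigroup_eq_zero (hα : 1 ≤ α) {F : Config d N → ℝ}
    (hF : ∀ k ∉ boundedConfigs d N n, F k = 0) (t : ℝ) :
    ∀ k ∉ boundedConfigs d N n, semigroup α χ t F k = 0 := by
  have hiter : ∀ m : ℕ, ∀ k ∉ boundedConfigs d N n, (generator α χ)^[m] F k = 0 := by
    intro m
    induction m with
    | zero => exact hF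
    | succ m ih => rw [Function.iterate_succ_apply']; exact generator_eq_zero hα ih
  intro k hk
  simp [semigroup, hiter _ k hk]

theorem semigroup_indicator (hα : 1 ≤ α) (t : ℝ) :
    semigroup α χ t ((boundedConfigs d N n : Set (Config d N)).indicator 1) =
      (boundedConfigs d N n : Set (Config d N)).indicator 1 := by
  ext k
  rw [semigroup, tsum_eq_single 0]
  · simp
  · intro m hm
    obtain ⟨m, rfl⟩ := Nat.exists_eq_succ_of_ne_zero hm
    have h0 : generator α χ (0 : Config d N → ℝ) = 0 := by
      have h := generator_sub (α := α) (χ := χ) (0 : Config d N → ℝ) 0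
      simpa using h
    have hzero : ∀ j : ℕ, (generator α χ)^[j] (0 : Config d N → ℝ) = 0 := fun j =>
      Function.iterate_fixed h0 j
    rw [Function.iterate_succ_apply, generator_indicator hα, hzero]
    simp

/-- The `m`-th term of the series is at most `t ^ m C ^ m c / m!`; from `m = 2` on, `t ≤ 1` allows
`t ^ 2` to be factored out. -/
theorem abs_semigroup_sub_le {C : ℝ} (hC : 0 ≤ C)
    (hgen : ∀ (F : Config d N → ℝ) (c : ℝ), (∀ k ∈ boundedConfigs d N n, |F k| ≤ c) →
      ∀ k ∈ boundedConfigs d N n, |generator α χ F k| ≤ C * c)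
    {F : Config d N → ℝ} {c : ℝ} (hF : ∀ k ∈ boundedConfigs d N n, |F k| ≤ c)
    {t : ℝ} (ht : 0 ≤ t) (ht1 : t ≤ 1) {k : Config d N} (hk : k ∈ boundedConfigs d N n) :
    |semigroup α χ t F k - (F k + t * generator α χ F k)| ≤ t ^ 2 * (Real.exp C * c) := by
  have hc : 0 ≤ c := (abs_nonneg _).trans (hF k hk)
  have hiter : ∀ m : ℕ, ∀ k ∈ boundedConfigs d N n, |(generator α χ)^[m] F k| ≤ C ^ m * c := by
    intro m
    induction m with
    | zero => simpa using hF
    | succ m ih =>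
      rw [Function.iterate_succ_apply', pow_succ', mul_assoc]
      exact hgen _ _ ih
  set f : ℕ → ℝ := fun m => t ^ m / (m ! : ℝ) * ((generator α χ)^[m] F) k with hf
  have hfle : ∀ m, |f m| ≤ t ^ m * (C ^ m / (m ! : ℝ) * c) := fun m => by
    rw [hf, abs_mul, abs_of_nonneg (by positivity)]
    calc _ ≤ t ^ m / (m ! : ℝ) * (C ^ m * c) := by gcongr; exact hiter m k hk
      _ = _ := by ring
  have hexp : Summable fun m : ℕ => C ^ m / (m ! : ℝ) * c :=
    (Real.summable_pow_div_factorial C).mul_right c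
  have hsum : Summable f := by
    refine Summable.of_norm_bounded hexp fun m => (hfle m).trans ?_
    exact mul_le_of_le_one_left (by positivity) (pow_le_one₀ ht ht1)
  have hsplit := hsum.sum_add_tsum_nat_add 2
  have h01 : ∑ m ∈ Finset.range 2, f m = F k + t * generator α χ F k := by
    simp [Finset.sum_range_succ, hf]
  have hexp2 : Summable fun m : ℕ => C ^ (m + 2) / ((m + 2)! : ℝ) * c :=
    (summable_nat_add_iff 2).2 hexp
  rw [semigroup, ← hsplit, h01, add_sub_cancel_left]
  have hle : ∀ m : ℕ, ‖f (m + 2)‖ ≤ t ^ 2 * (C ^ (m + 2) / ((m + 2)! : ℝ) * c) := fun m => by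
    refine (hfle (m + 2)).trans (mul_le_mul_of_nonneg_right ?_ (by positivity))
    rw [pow_add]
    exact mul_le_of_le_one_left (by positivity) (pow_le_one₀ ht ht1)
  refine (tsum_of_norm_bounded (hexp2.mul_left (t ^ 2)).hasSum hle).trans ?_
  rw [tsum_mul_left]
  refine mul_le_mul_of_nonneg_left ?_ (by positivity)
  have hall := hexp.sum_add_tsum_nat_add 2
  have hexpC : ∑' m : ℕ, C ^ m / (m ! : ℝ) * c = Real.exp C * c := by
    rw [tsum_mul_right, Real.exp_eq_exp_ℝ, NormedSpace.exp_eq_tsum_div]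
  rw [hexpC] at hall
  have hfirst : 0 ≤ ∑ m ∈ Finset.range 2, C ^ m / (m ! : ℝ) * c :=
    Finset.sum_nonneg fun m _ => by positivity
  linarith

end Semigroup

/-! ### `L²` growth of the time-discretised Feynman-Kac semigroup -/

section FeynmanKac

variable {d N : ℕ} [NeZero N] {α χ : ℝ} {n : ℕ}

/-- One step of the time-discretised Feynman-Kac semigroup with potential `W`. -/
noncomputable def feynmanKacStep (α χ : ℝ) (W : Config d N → ℝ) (h : ℝ) (F : Config d N → ℝ) :
    Config d N → ℝ :=
  semigroup α χ h fun k => Real.exp (h * W k) * F k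

theorem feynmanKacStep_eq_zero (hα : 1 ≤ α) (W : Config d N → ℝ) (h : ℝ) {F : Config d N → ℝ}
    (hF : ∀ k ∉ boundedConfigs d N n, F k = 0) :
    ∀ k ∉ boundedConfigs d N n, feynmanKacStep α χ W h F k = 0 :=
  semigroup_eq_zero hα (fun k hk => by rw [hF k hk, mul_zero]) h

/-- The constant may depend arbitrarily on `N`, `n` and `W`: the time step tends to zero with the
system fixed. -/
theorem exists_feynmanKacStep_expansion (hα : 1 ≤ α) (hχ : 0 < χ) (n : ℕ) (W : Config d N → ℝ) :
    ∃ C : ℝ, 0 ≤ C ∧ ∃ h₀ > (0 : ℝ), h₀ ≤ 1 ∧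
      ∀ (F : Config d N → ℝ) (c : ℝ), (∀ k ∈ boundedConfigs d N n, |F k| ≤ c) →
      ∀ h, 0 ≤ h → h ≤ h₀ → ∀ k ∈ boundedConfigs d N n,
        |generator α χ F k + W k * F k| ≤ C * c ∧
        |feynmanKacStep α χ W h F k - (F k + h * (generator α χ F k + W k * F k))| ≤
          C * h ^ 2 * c := by
  obtain ⟨C, hC, hgen⟩ := exists_generator_bound (d := d) (N := N) hα hχ n
  obtain ⟨w, hw, hW⟩ : ∃ w : ℝ, 0 ≤ w ∧ ∀ k ∈ boundedConfigs d N n, |W k| ≤ w :=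
    ⟨∑ k ∈ boundedConfigs d N n, |W k|, Finset.sum_nonneg fun _ _ => abs_nonneg _, fun k hk =>
      Finset.single_le_sum (f := fun k => |W k|) (fun _ _ => abs_nonneg _) hk⟩
  -- The step size ensures both `h ≤ 1` and `h w ≤ 1`, so that the Taylor bounds for `exp` near zero
  -- apply.
  refine ⟨C + w + w ^ 2 + 2 * w * C + Real.exp C * 3, by positivity, 1 / (1 + w), by positivity,
    by rw [div_le_one (by positivity)]; linarith, ?_⟩
  intro F c hF h h0 hle k hk
  have hc : 0 ≤ c := (abs_nonneg _).trans (hF k hk)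
  have hhw : h * (1 + w) ≤ 1 := by rwa [le_div_iff₀ (by positivity)] at hle
  have hh1 : h ≤ 1 := by nlinarith
  have hE : 0 ≤ Real.exp C := (Real.exp_pos C).le
  set G : Config d N → ℝ := fun k => Real.exp (h * W k) * F k with hG
  have hsmall : ∀ k ∈ boundedConfigs d N n, |h * W k| ≤ h * w ∧ |h * W k| ≤ 1 := fun k hk => by
    have h1 : |h * W k| ≤ h * w := by
      rw [abs_mul, abs_of_nonneg h0]; exact mul_le_mul_of_nonneg_left (hW k hk) h0
    exact ⟨h1, h1.trans (by nlinarith)⟩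
  have hGF : ∀ k ∈ boundedConfigs d N n, |(G - F) k| ≤ 2 * (h * w) * c := fun k hk => by
    have h1 : (G - F) k = (Real.exp (h * W k) - 1) * F k := by simp [hG]; ring
    rw [h1, abs_mul]
    have h2 := Real.abs_exp_sub_one_le (hsmall k hk).2
    exact mul_le_mul (h2.trans (mul_le_mul_of_nonneg_left (hsmall k hk).1 (by norm_num)))
      (hF k hk) (abs_nonneg _) (by positivity)
  have hG3 : ∀ k ∈ boundedConfigs d N n, |G k| ≤ 3 * c := fun k hk => by
    have h1 : G k = (G - F) k + F k := by simp
    rw [h1]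
    have h2 : 2 * (h * w) * c ≤ 2 * c := by nlinarith
    linarith [abs_add_le ((G - F) k) (F k), hGF k hk, hF k hk]
  have e1 : |G k - (F k + h * W k * F k)| ≤ (h * w) ^ 2 * c := by
    have h1 : G k - (F k + h * W k * F k) = (Real.exp (h * W k) - 1 - h * W k) * F k := by
      simp only [hG]; ring
    rw [h1, abs_mul]
    have h2 := Real.abs_exp_sub_one_sub_id_le (hsmall k hk).2
    refine mul_le_mul (h2.trans ?_) (hF k hk) (abs_nonneg _) (by positivity)
    rw [← sq_abs]
    exact pow_le_pow_left₀ (abs_nonneg _) (hsmall k hk).1 2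
  have e2 : |generator α χ G k - generator α χ F k| ≤ C * (2 * (h * w) * c) := by
    have h1 := hgen (G - F) _ hGF k hk
    rwa [generator_sub] at h1
  have e3 := abs_semigroup_sub_le hC hgen hG3 h0 hh1 hk
  constructor
  · have h1 := abs_add_le (generator α χ F k) (W k * F k)
    have h2 := hgen F c hF k hk
    have h3 : |W k * F k| ≤ w * c := by
      rw [abs_mul]; exact mul_le_mul (hW k hk) (hF k hk) (abs_nonneg _) hw
    have h4 : 0 ≤ (w ^ 2 + 2 * w * C + Real.exp C * 3) * c := by positivity
    linarith
  · have hsplit : feynmanKacStep α χ W h F k - (F k + h * (generator α χ F k + W k * F k)) =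
        (semigroup α χ h G k - (G k + h * generator α χ G k)) +
        (G k - (F k + h * W k * F k)) + h * (generator α χ G k - generator α χ F k) := by
      rw [feynmanKacStep]; ring
    rw [hsplit]
    refine (abs_add_three _ _ _).trans ?_
    rw [abs_mul h, abs_of_nonneg h0]
    have h1 := mul_le_mul_of_nonneg_left e2 h0
    have h2 : 0 ≤ (C + w) * h ^ 2 * c := by positivity
    nlinarith

/-- Squaring the first-order expansion gives `F² + 2h F (L + W) F + O(h²)`. The form bound controls
the middle term, and `1 + x ≤ exp x` puts the growth into a form that can be iterated. -/
theorem exists_feynmanKacStep_bound (hα : 1 ≤ α) (hχ : 0 < χ) {a : ℝ} (ha : 0 < a) (n : ℕ)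
    (W : Config d N → ℝ) {Λ : ℝ}
    (hform : ∀ F : Config d N → ℝ, (∀ k ∉ boundedConfigs d N n, F k = 0) →
      ∑ k ∈ boundedConfigs d N n, weight α (a / χ) k * (F k * (generator α χ F k + W k * F k)) ≤
        Λ * ∑ k ∈ boundedConfigs d N n, weight α (a / χ) k * F k ^ 2) :
    ∃ C : ℝ, 0 ≤ C ∧ ∃ h₀ > (0 : ℝ), ∀ h, 0 ≤ h → h ≤ h₀ → ∀ F : Config d N → ℝ,
      (∀ k ∉ boundedConfigs d N n, F k = 0) →
      ∑ k ∈ boundedConfigs d N n, weight α (a / χ) k * feynmanKacStep α χ W h F k ^ 2 ≤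
        Real.exp (2 * h * Λ + C * h ^ 2) *
          ∑ k ∈ boundedConfigs d N n, weight α (a / χ) k * F k ^ 2 := by
  have hw : ∀ k : Config d N, 0 < weight α (a / χ) k := weight_pos hα (div_pos ha hχ)
  obtain ⟨C, hC, h₀, hh₀, hh₀1, hexp⟩ := exists_feynmanKacStep_expansion hα hχ n W
  set w := ∑ k ∈ boundedConfigs d N n, weight α (a / χ) k with hwdef
  set v := ∑ k ∈ boundedConfigs d N n, (weight α (a / χ) k)⁻¹ with hv
  have hw0 : 0 ≤ w := Finset.sum_nonneg fun k _ => (hw k).le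
  have hv0 : 0 ≤ v := Finset.sum_nonneg fun k _ => (inv_pos.2 (hw k)).le
  set D := C ^ 2 + 2 * (1 + C) * C + C ^ 2 with hD
  have hD0 : 0 ≤ D := by positivity
  refine ⟨w * (D * v), by positivity, h₀, hh₀, ?_⟩
  intro h h0 hle F hF
  set m := ∑ k ∈ boundedConfigs d N n, weight α (a / χ) k * F k ^ 2 with hm
  have hm0 : 0 ≤ m := Finset.sum_nonneg fun k _ => mul_nonneg (hw k).le (sq_nonneg _)
  -- On a finite set with positive weights the sup norm is controlled by the weighted `L²` norm, so
  -- the `O(h²)` error is relative to `m`.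
  have hc : ∀ k ∈ boundedConfigs d N n, |F k| ≤ √(v * m) := fun k hk => by
    refine Real.abs_le_sqrt ?_
    have h1 : weight α (a / χ) k * F k ^ 2 ≤ m :=
      Finset.single_le_sum (f := fun k => weight α (a / χ) k * F k ^ 2)
        (fun k _ => mul_nonneg (hw k).le (sq_nonneg _)) hk
    have h2 : (weight α (a / χ) k)⁻¹ ≤ v :=
      Finset.single_le_sum (f := fun k => (weight α (a / χ) k)⁻¹)
        (fun k _ => (inv_pos.2 (hw k)).le) hk
    calc F k ^ 2 = (weight α (a / χ) k)⁻¹ * (weight α (a / χ) k * F k ^ 2) := by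
          field_simp [(hw k).ne']
      _ ≤ v * m := mul_le_mul h2 h1 (mul_nonneg (hw k).le (sq_nonneg _)) hv0
  set c := √(v * m) with hcdef
  have hc0 : 0 ≤ c := Real.sqrt_nonneg _
  have hc2 : c ^ 2 = v * m := Real.sq_sqrt (by positivity)
  have hpoint : ∀ k ∈ boundedConfigs d N n, feynmanKacStep α χ W h F k ^ 2 ≤
      F k ^ 2 + 2 * h * (F k * (generator α χ F k + W k * F k)) + D * h ^ 2 * c ^ 2 := by
    intro k hk
    obtain ⟨e1, e2⟩ := hexp F c hc h h0 hle k hk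
    have e0 := hc k hk
    generalize F k = f at *
    generalize generator α χ F k + W k * f = g at *
    obtain ⟨r, hr⟩ : ∃ r, r = feynmanKacStep α χ W h F k - (f + h * g) := ⟨_, rfl⟩
    rw [← hr] at e2
    have hstep : feynmanKacStep α χ W h F k = f + h * g + r := by rw [hr]; ring
    rw [hstep]
    have hh1 : h ≤ 1 := hle.trans hh₀1
    have b1 : g ^ 2 ≤ (C * c) ^ 2 := sq_le_sq' (abs_le.1 e1).1 (abs_le.1 e1).2
    have b2 : |f + h * g| ≤ (1 + C) * c := by
      have h1 := abs_add_le f (h * g)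
      rw [abs_mul, abs_of_nonneg h0] at h1
      have h2 : h * |g| ≤ C * c :=
        (mul_le_of_le_one_left (abs_nonneg _) hh1).trans e1
      linarith
    have b3 : (f + h * g) * r ≤ ((1 + C) * c) * (C * h ^ 2 * c) := by
      refine (le_abs_self _).trans ?_
      rw [abs_mul]
      exact mul_le_mul b2 e2 (abs_nonneg _) (by positivity)
    have b4 : r ^ 2 ≤ (C * h ^ 2 * c) ^ 2 := sq_le_sq' (abs_le.1 e2).1 (abs_le.1 e2).2
    have b5 : (C * h ^ 2 * c) ^ 2 ≤ C ^ 2 * c ^ 2 * h ^ 2 := by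
      have h4 : h ^ 4 ≤ h ^ 2 := pow_le_pow_of_le_one h0 hh1 (by norm_num)
      calc (C * h ^ 2 * c) ^ 2 = C ^ 2 * c ^ 2 * h ^ 4 := by ring
        _ ≤ _ := by gcongr
    have b6 := mul_le_mul_of_nonneg_left b1 (sq_nonneg h)
    calc (f + h * g + r) ^ 2
        = f ^ 2 + 2 * h * (f * g) + h ^ 2 * g ^ 2 + 2 * ((f + h * g) * r) + r ^ 2 := by ring
      _ ≤ f ^ 2 + 2 * h * (f * g) + h ^ 2 * (C * c) ^ 2 +
          2 * (((1 + C) * c) * (C * h ^ 2 * c)) + C ^ 2 * c ^ 2 * h ^ 2 := by linarith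
      _ = _ := by rw [hD]; ring
  calc ∑ k ∈ boundedConfigs d N n, weight α (a / χ) k * feynmanKacStep α χ W h F k ^ 2
      ≤ ∑ k ∈ boundedConfigs d N n, weight α (a / χ) k * (F k ^ 2 +
        2 * h * (F k * (generator α χ F k + W k * F k)) + D * h ^ 2 * c ^ 2) :=
        Finset.sum_le_sum fun k hk => mul_le_mul_of_nonneg_left (hpoint k hk) (hw k).le
    _ = m + 2 * h * ∑ k ∈ boundedConfigs d N n,
          weight α (a / χ) k * (F k * (generator α χ F k + W k * F k)) +
        w * (D * h ^ 2 * c ^ 2) := by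
        rw [hm, hwdef, Finset.mul_sum, Finset.sum_mul, ← Finset.sum_add_distrib,
          ← Finset.sum_add_distrib]
        exact Finset.sum_congr rfl fun k _ => by ring
    _ ≤ m + 2 * h * (Λ * m) + w * (D * h ^ 2 * c ^ 2) := by gcongr; exact hform F hF
    _ = (2 * h * Λ + w * (D * v) * h ^ 2 + 1) * m := by rw [hc2]; ring
    _ ≤ _ := mul_le_mul_of_nonneg_right (Real.add_one_le_exp _) hm0

/-- Iterate the `L²` bound from the indicator, then apply Cauchy-Schwarz against total weight at
most one; the square root halves the exponent. -/
theorem sum_iterate_feynmanKacStep_le (hα : 1 ≤ α) (hχ : 0 < χ) {a : ℝ} (ha : 0 < a)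
    {W : Config d N → ℝ} {Λ C h : ℝ}
    (hweight : ∑ k ∈ boundedConfigs d N n, weight α (a / χ) k ≤ 1)
    (hstep : ∀ F : Config d N → ℝ, (∀ k ∉ boundedConfigs d N n, F k = 0) →
      ∑ k ∈ boundedConfigs d N n, weight α (a / χ) k * feynmanKacStep α χ W h F k ^ 2 ≤
        Real.exp (2 * h * Λ + C * h ^ 2) *
          ∑ k ∈ boundedConfigs d N n, weight α (a / χ) k * F k ^ 2) (m : ℕ) :
    ∑ k ∈ boundedConfigs d N n, weight α (a / χ) k * (feynmanKacStep α χ W h)^[m]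
        ((boundedConfigs d N n : Set (Config d N)).indicator 1) k ≤
      Real.exp (m * (h * Λ + C * h ^ 2 / 2)) := by
  have hw : ∀ k : Config d N, 0 < weight α (a / χ) k := weight_pos hα (div_pos ha hχ)
  set F₀ : Config d N → ℝ := (boundedConfigs d N n : Set (Config d N)).indicator 1 with hF₀
  have hmain : (∀ k ∉ boundedConfigs d N n, (feynmanKacStep α χ W h)^[m] F₀ k = 0) ∧
      ∑ k ∈ boundedConfigs d N n, weight α (a / χ) k * (feynmanKacStep α χ W h)^[m] F₀ k ^ 2 ≤
        Real.exp (m * (2 * h * Λ + C * h ^ 2)) := by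
    induction m with
    | zero =>
      refine ⟨fun k hk => by simp [hF₀, hk], ?_⟩
      rw [Nat.cast_zero, zero_mul, Real.exp_zero]
      refine le_trans (le_of_eq (Finset.sum_congr rfl fun k hk => ?_)) hweight
      simp [hF₀, hk]
    | succ m ih =>
      simp only [Function.iterate_succ_apply']
      refine ⟨feynmanKacStep_eq_zero hα W h ih.1, (hstep _ ih.1).trans ?_⟩
      refine (mul_le_mul_of_nonneg_left ih.2 (Real.exp_pos _).le).trans (le_of_eq ?_)
      rw [← Real.exp_add]
      congr 1
      push_cast
      ring
  have hcs := Finset.sum_mul_sq_le_sq_mul_sq (boundedConfigs d N n)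
    (fun k => √(weight α (a / χ) k))
    (fun k => √(weight α (a / χ) k) * (feynmanKacStep α χ W h)^[m] F₀ k)
  simp only [mul_pow, Real.sq_sqrt (hw _).le, ← mul_assoc, Real.mul_self_sqrt (hw _).le] at hcs
  refine (le_abs_self _).trans (abs_le_of_sq_le_sq ?_ (Real.exp_pos _).le)
  calc _ ≤ _ := hcs
    _ ≤ 1 * Real.exp (m * (2 * h * Λ + C * h ^ 2)) := by
        refine mul_le_mul hweight hmain.2 (Finset.sum_nonneg fun k _ =>
          mul_nonneg (hw k).le (sq_nonneg _)) zero_le_one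
    _ = _ := by
        rw [one_mul, ← Real.exp_nat_mul]
        congr 1
        push_cast
        ring

end FeynmanKac

/-! ### Riemann sums along right-continuous step paths -/

section RiemannSums

/-- Right Riemann sums converge for functions which are locally constant on the right. -/
theorem tendsto_riemannSum {f : ℝ → ℝ} {B T : ℝ} (hT : 0 < T) (hB : ∀ t, 0 ≤ t → |f t| ≤ B)
    (hright : ∀ t, 0 ≤ t → ∀ᶠ s in 𝓝[>] t, f s = f t) :
    Tendsto (fun n : ℕ => ∑ i ∈ Finset.range n, T / n * f ((i + 1) * (T / n))) atTop
      (𝓝 (∫ t in (0 : ℝ)..T, f t)) := by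
  set g : ℕ → ℝ → ℝ := fun n t => f ((⌊t / (T / n)⌋₊ + 1) * (T / n)) with hg
  have hmeas : ∀ n, Measurable (g n) := fun n =>
    (measurable_from_nat (f := fun j : ℕ => f ((j + 1) * (T / n)))).comp
      (Nat.measurable_floor.comp (measurable_id.div_const _))
  have hbound : ∀ n t, ‖g n t‖ ≤ B := fun n t => hB _ (by positivity)
  have hint : ∀ n a b, IntervalIntegrable (g n) volume a b := fun n a b =>
    (intervalIntegrable_const (c := B)).mono_fun' (hmeas n).aestronglyMeasurable
      (Eventually.of_forall (hbound n))
  have hlim : Tendsto (fun n => ∫ t in (0 : ℝ)..T, g n t) atTop (𝓝 (∫ t in (0 : ℝ)..T, f t)) := by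
    refine intervalIntegral.tendsto_integral_filter_of_dominated_convergence (fun _ => B)
      (Eventually.of_forall fun n => (hmeas n).aestronglyMeasurable)
      (Eventually.of_forall fun n => Eventually.of_forall fun t _ => hbound n t)
      intervalIntegrable_const (Eventually.of_forall fun t ht => ?_)
    rw [Set.uIoc_of_le hT.le] at ht
    have hTn : Tendsto (fun n : ℕ => t + T / n) atTop (𝓝 t) := by
      simpa using (tendsto_const_div_atTop_nhds_zero_nat T).const_add t
    -- The `+ 1` keeps the sampling point strictly to the right of `t`, where `f` eventually equals
    -- `f t`.
    have hpt : Tendsto (fun n : ℕ => ((⌊t / (T / n)⌋₊ : ℝ) + 1) * (T / n)) atTop (𝓝[>] t) := by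
      have hev : ∀ᶠ n : ℕ in atTop, t < ((⌊t / (T / n)⌋₊ : ℝ) + 1) * (T / n) ∧
          ((⌊t / (T / n)⌋₊ : ℝ) + 1) * (T / n) ≤ t + T / n := by
        filter_upwards [eventually_gt_atTop 0] with n hn
        have hh : 0 < T / n := div_pos hT (by exact_mod_cast hn)
        constructor
        · rw [← div_lt_iff₀ hh]; exact Nat.lt_floor_add_one _
        · have := Nat.floor_le (div_nonneg ht.1.le hh.le)
          rw [le_div_iff₀ hh] at this
          linarith
      refine tendsto_nhdsWithin_iff.2 ⟨?_, hev.mono fun n hn => hn.1⟩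
      exact tendsto_of_tendsto_of_tendsto_of_le_of_le' tendsto_const_nhds hTn
        (hev.mono fun n hn => hn.1.le) (hev.mono fun n hn => hn.2)
    exact tendsto_nhds_of_eventually_eq (hpt.eventually (hright t ht.1.le))
  refine hlim.congr' ?_
  filter_upwards [eventually_gt_atTop 0] with n hn
  have hn' : (0 : ℝ) < n := by exact_mod_cast hn
  have hh : 0 < T / n := div_pos hT hn'
  have hsum := intervalIntegral.sum_integral_adjacent_intervals (f := g n) (μ := volume)
    (a := fun i : ℕ => (i : ℝ) * (T / n)) (n := n) fun k _ => hint n _ _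
  have hend : (n : ℝ) * (T / n) = T := by field_simp
  simp only [Nat.cast_zero, zero_mul, hend] at hsum
  rw [← hsum]
  refine Finset.sum_congr rfl fun i _ => ?_
  have hle : (i : ℝ) * (T / n) ≤ ((i + 1 : ℕ) : ℝ) * (T / n) := by
    push_cast; nlinarith
  have hconst : ∫ t in (i : ℝ) * (T / n)..((i + 1 : ℕ) : ℝ) * (T / n), g n t =
      ∫ _t in (i : ℝ) * (T / n)..((i + 1 : ℕ) : ℝ) * (T / n), f ((i + 1) * (T / n)) := by
    rw [intervalIntegral.integral_of_le hle, intervalIntegral.integral_of_le hle,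
      integral_Ioc_eq_integral_Ioo, integral_Ioc_eq_integral_Ioo]
    refine setIntegral_congr_fun measurableSet_Ioo fun t ht => ?_
    have hfloor : ⌊t / (T / n)⌋₊ = i := by
      rw [Nat.floor_eq_iff (div_nonneg (le_trans (by positivity) ht.1.le) hh.le),
        le_div_iff₀ hh, div_lt_iff₀ hh]
      refine ⟨ht.1.le, ?_⟩
      have := ht.2
      push_cast at this
      exact this
    simp only [hg, hfloor]
  rw [hconst, intervalIntegral.integral_const, smul_eq_mul]
  push_cast
  ring

end RiemannSums

/-! ### From the Markov property to exponential bounds -/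

section MarkovDynamics

variable {d N : ℕ} [NeZero N] {Ω : Type*} {α χ : ℝ} {K : ℝ → Ω → Config d N} {n : ℕ}

theorem measurable_history {r s : ℝ} (hr : 0 ≤ r) (hrs : r ≤ s) (F : Config d N → ℝ) :
    Measurable[history K s] fun ω => F (K r ω) := by
  have h : Measurable[history K s] (K r) := by
    rw [measurable_iff_comap_le]
    exact le_iSup₂ (f := fun r (_ : r ∈ Set.Icc (0 : ℝ) s) =>
      MeasurableSpace.comap (K r) inferInstance) r ⟨hr, hrs⟩
  exact (Measurable.of_discrete (f := F)).comp h

variable [MeasurableSpace Ω] {P : Measure Ω}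

theorem exists_bound_of_support {F : Config d N → ℝ} (hF : ∀ k ∉ boundedConfigs d N n, F k = 0) :
    ∃ C, ∀ k, |F k| ≤ C := by
  refine ⟨∑ k ∈ boundedConfigs d N n, |F k|, fun k => ?_⟩
  by_cases hk : k ∈ boundedConfigs d N n
  · exact Finset.single_le_sum (f := fun k => |F k|) (fun _ _ => abs_nonneg _) hk
  · rw [hF k hk, abs_zero]; exact Finset.sum_nonneg fun _ _ => abs_nonneg _

theorem history_le (hK : IsRescaledZeroRangeProcess α χ P K) (s : ℝ) :
    history K s ≤ ‹MeasurableSpace Ω› :=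
  iSup₂_le fun r hr => (hK.measurable r hr.1).comap_le

variable [IsProbabilityMeasure P]

theorem integral_mul_markov (hK : IsRescaledZeroRangeProcess α χ P K) {s t : ℝ} (hs : 0 ≤ s)
    (ht : 0 ≤ t) {X : Ω → ℝ} (hX : Measurable[history K s] X) {B : ℝ} (hXB : ∀ ω, |X ω| ≤ B)
    {F : Config d N → ℝ} (hF : ∃ C, ∀ k, |F k| ≤ C) :
    ∫ ω, X ω * F (K (s + t) ω) ∂P = ∫ ω, X ω * semigroup α χ t F (K s ω) ∂P := by
  obtain ⟨C, hC⟩ := hF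
  have hm := history_le hK s
  have hmeas : Measurable fun ω => F (K (s + t) ω) :=
    Measurable.of_discrete.comp (hK.measurable _ (add_nonneg hs ht))
  have hint : Integrable (fun ω => F (K (s + t) ω)) P :=
    Integrable.of_bound hmeas.aestronglyMeasurable C (Eventually.of_forall fun ω => hC _)
  have hintX : Integrable (X * fun ω => F (K (s + t) ω)) P :=
    hint.bdd_mul (hX.mono hm le_rfl).aestronglyMeasurable (Eventually.of_forall hXB)
  have h1 := condExp_mul_of_stronglyMeasurable_left hX.stronglyMeasurable hintX hint
  have h2 := hK.markov s t hs ht F ⟨C, hC⟩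
  calc ∫ ω, X ω * F (K (s + t) ω) ∂P
      = ∫ ω, (P[X * fun ω => F (K (s + t) ω) | history K s]) ω ∂P := (integral_condExp hm).symm
    _ = _ := by
        refine integral_congr_ae ?_
        filter_upwards [h1, h2] with ω e1 e2
        rw [e1, Pi.mul_apply, e2]

/-- The indicator of the configurations with at most `n` particles. -/
noncomputable def boundedIndicator (d N n : ℕ) [NeZero N] : Config d N → ℝ :=
  (boundedConfigs d N n : Set (Config d N)).indicator 1

theorem boundedIndicator_of_mem {k : Config d N} (hk : k ∈ boundedConfigs d N n) :
    boundedIndicator d N n k = 1 := by simp [boundedIndicator, hk]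

theorem boundedIndicator_of_notMem {k : Config d N} (hk : k ∉ boundedConfigs d N n) :
    boundedIndicator d N n k = 0 := by simp [boundedIndicator, hk]

theorem abs_boundedIndicator_le (k : Config d N) : |boundedIndicator d N n k| ≤ 1 := by
  by_cases hk : k ∈ boundedConfigs d N n
  · simp [boundedIndicator_of_mem hk]
  · simp [boundedIndicator_of_notMem hk]

/-- The semigroup fixes the indicator, so the nonnegative variable `F(K 0)² - F(K 0) F(K t)` has
mean zero and vanishes almost surely. -/
theorem ae_mem_boundedConfigs_at (hα : 1 ≤ α) (hK : IsRescaledZeroRangeProcess α χ P K) {t : ℝ}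
    (ht : 0 ≤ t) :
    ∀ᵐ ω ∂P, K 0 ω ∈ boundedConfigs d N n → K t ω ∈ boundedConfigs d N n := by
  set F := boundedIndicator d N n with hF
  have hmeas : ∀ s, 0 ≤ s → Measurable fun ω => F (K s ω) := fun s hs =>
    Measurable.of_discrete.comp (hK.measurable s hs)
  have hX : Measurable[history K 0] fun ω => F (K 0 ω) := measurable_history le_rfl le_rfl F
  have h := integral_mul_markov hK le_rfl ht hX (B := 1) (fun ω => abs_boundedIndicator_le _)
    (F := F) ⟨1, abs_boundedIndicator_le⟩
  have hint : ∀ s, 0 ≤ s → Integrable (fun ω => F (K 0 ω) * F (K s ω)) P := fun s hs =>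
    Integrable.of_bound ((hmeas 0 le_rfl).mul (hmeas s hs)).aestronglyMeasurable 1
      (Eventually.of_forall fun ω => by
        rw [norm_mul]
        exact mul_le_one₀ (abs_boundedIndicator_le _) (norm_nonneg _) (abs_boundedIndicator_le _))
  have hle : ∀ ω, 0 ≤ F (K 0 ω) * F (K 0 ω) - F (K 0 ω) * F (K t ω) := fun ω => by
    by_cases h0 : K 0 ω ∈ boundedConfigs d N n
    · rw [hF, boundedIndicator_of_mem h0]
      linarith [(abs_le.1 (abs_boundedIndicator_le (n := n) (K t ω))).2]
    · rw [hF, boundedIndicator_of_notMem h0]; simp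
  have hzero : ∫ ω, (F (K 0 ω) * F (K 0 ω) - F (K 0 ω) * F (K t ω)) ∂P = 0 := by
    rw [integral_sub (hint 0 le_rfl) (hint t ht), sub_eq_zero]
    rw [zero_add, hF, boundedIndicator, semigroup_indicator hα] at h
    exact h.symm
  have hae := (integral_eq_zero_iff_of_nonneg hle ((hint 0 le_rfl).sub (hint t ht))).1 hzero
  filter_upwards [hae] with ω hω h0
  by_contra hn
  simp [hF, boundedIndicator_of_mem h0, boundedIndicator_of_notMem hn] at hω

/-- The number of particles stays bounded by its initial value. -/
theorem ae_mem_boundedConfigs (hα : 1 ≤ α) (hK : IsRescaledZeroRangeProcess α χ P K) :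
    ∀ᵐ ω ∂P, K 0 ω ∈ boundedConfigs d N n →
      ∀ t, 0 ≤ t → K t ω ∈ boundedConfigs d N n := by
  have hrat : ∀ᵐ ω ∂P, ∀ q : ℚ, 0 ≤ (q : ℝ) → K 0 ω ∈ boundedConfigs d N n →
      K q ω ∈ boundedConfigs d N n := by
    rw [ae_all_iff]
    intro q
    by_cases hq : 0 ≤ (q : ℝ)
    · filter_upwards [ae_mem_boundedConfigs_at (n := n) hα hK hq] with ω hω _ using hω
    · exact Eventually.of_forall fun ω h => absurd h hq
  filter_upwards [hrat, hK.right_continuous] with ω hω hright h0 t ht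
  -- The path is constant just after `t`, so its value at `t` is also attained at a rational time.
  obtain ⟨b, hb, hbt⟩ := mem_nhdsGT_iff_exists_Ioo_subset.1 (hright t ht)
  obtain ⟨q, hq1, hq2⟩ := exists_rat_btwn (Set.mem_Ioi.1 hb)
  have heq : K q ω = K t ω := hbt ⟨hq1, hq2⟩
  exact heq ▸ hω q (ht.trans hq1.le) h0

/-- Conditioning on the history up to the last but one time peels off one Feynman-Kac step. The
indicators in every factor keep the product bounded although `W` is arbitrary. -/
theorem integral_prod_eq_iterate (hα : 1 ≤ α) (hK : IsRescaledZeroRangeProcess α χ P K)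
    (W : Config d N → ℝ) {h : ℝ} (hh : 0 ≤ h) (m : ℕ) {F : Config d N → ℝ}
    (hF : ∀ k ∉ boundedConfigs d N n, F k = 0) :
    ∫ ω, boundedIndicator d N n (K 0 ω) * (∏ i ∈ Finset.range m,
      boundedIndicator d N n (K ((i + 1) * h) ω) * Real.exp (h * W (K ((i + 1) * h) ω))) *
        F (K (m * h) ω) ∂P =
    ∫ ω, boundedIndicator d N n (K 0 ω) * (feynmanKacStep α χ W h)^[m] F (K 0 ω) ∂P := by
  induction m generalizing F with
  | zero => simp
  | succ m ih =>
    rw [Function.iterate_succ_apply, ← ih (feynmanKacStep_eq_zero hα W h hF)]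
    set ρ : Config d N → ℝ := fun k => boundedIndicator d N n k * Real.exp (h * W k) with hρ
    have hsupp : ∀ k ∉ boundedConfigs d N n, ρ k = 0 := fun k hk => by
      rw [hρ]; simp only [boundedIndicator_of_notMem hk, zero_mul]
    obtain ⟨C, hC⟩ := exists_bound_of_support hsupp
    have hρF : ∀ k, ρ k * F k = Real.exp (h * W k) * F k := fun k => by
      by_cases hk : k ∈ boundedConfigs d N n
      · simp only [hρ, boundedIndicator_of_mem hk, one_mul]
      · rw [hF k hk, mul_zero, mul_zero]
    have hX : Measurable[history K (m * h)] fun ω => boundedIndicator d N n (K 0 ω) *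
        ∏ i ∈ Finset.range m, ρ (K ((i + 1) * h) ω) := by
      refine Measurable.mul (measurable_history le_rfl (by positivity) _)
        (Finset.measurable_fun_prod _ fun i hi => measurable_history (by positivity) ?_ ρ)
      have : ((i + 1 : ℕ) : ℝ) ≤ m := by exact_mod_cast Finset.mem_range.1 hi
      push_cast at this
      exact mul_le_mul_of_nonneg_right this hh
    have hXB : ∀ ω, |boundedIndicator d N n (K 0 ω) *
        ∏ i ∈ Finset.range m, ρ (K ((i + 1) * h) ω)| ≤ 1 * C ^ m := fun ω => by
      rw [abs_mul, Finset.abs_prod]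
      refine mul_le_mul (abs_boundedIndicator_le _) ?_
        (Finset.prod_nonneg fun _ _ => abs_nonneg _) zero_le_one
      refine (Finset.prod_le_prod (fun _ _ => abs_nonneg _) fun i _ => hC _).trans ?_
      simp
    have hmarkov := integral_mul_markov hK (s := m * h) (by positivity) hh hX hXB
      (F := fun k => Real.exp (h * W k) * F k)
      (exists_bound_of_support (n := n) fun k hk => by rw [hF k hk, mul_zero])
    rw [feynmanKacStep]
    refine Eq.trans (integral_congr_ae (Eventually.of_forall fun ω => ?_)) hmarkov
    have htime : ((m + 1 : ℕ) : ℝ) * h = m * h + h := by push_cast; ring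
    have htime' : ((m : ℝ) + 1) * h = m * h + h := by ring
    simp only [Finset.prod_range_succ, htime, htime', ← hρF]
    simp only [hρ]
    ring

theorem equilibrium_singleton (α χ a : ℝ) (k : Config d N) :
    equilibrium d N α χ a {k} = ENNReal.ofReal (weight α (a / χ) k) := by
  rw [equilibrium, Measure.sum_apply _ (measurableSet_singleton k), tsum_eq_single k]
  · simp [weight]
  · intro j hj
    simp [hj]

theorem sum_weight_le_one (hα : 1 ≤ α) (hχ : 0 < χ) {a : ℝ} (ha : 0 < a)
    [IsProbabilityMeasure (equilibrium d N α χ a)] :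
    ∑ k ∈ boundedConfigs d N n, weight α (a / χ) k ≤ 1 := by
  have h := sum_measureReal_singleton (μ := equilibrium d N α χ a) (boundedConfigs d N n)
  simp only [Measure.real, equilibrium_singleton,
    ENNReal.toReal_ofReal (weight_pos hα (div_pos ha hχ) _).le] at h
  rw [h]
  exact measureReal_le_one

theorem integral_equilibrium (hα : 1 ≤ α) (hχ : 0 < χ) {a : ℝ} (ha : 0 < a)
    [IsProbabilityMeasure (equilibrium d N α χ a)] (F : Config d N → ℝ) :
    ∫ k, boundedIndicator d N n k * F k ∂(equilibrium d N α χ a) =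
      ∑ k ∈ boundedConfigs d N n, weight α (a / χ) k * F k := by
  have hG : ∀ k, k ∉ (boundedConfigs d N n : Set (Config d N)) →
      boundedIndicator d N n k * F k = 0 := fun k hk => by
    rw [boundedIndicator_of_notMem hk, zero_mul]
  rw [← setIntegral_eq_integral_of_forall_compl_eq_zero hG, setIntegral_finset]
  · refine Finset.sum_congr rfl fun k hk => ?_
    rw [boundedIndicator_of_mem hk, Measure.real, equilibrium_singleton,
      ENNReal.toReal_ofReal (weight_pos hα (div_pos ha hχ) _).le, one_mul, smul_eq_mul]
  · exact IntegrableOn.finset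

/-- Exponential Chebyshev bound for additive functionals, through the form bound of `L + W`. -/
theorem measure_additiveFunctional_le (hα : 1 ≤ α) (hχ : 0 < χ) {a : ℝ} (ha : 0 < a)
    (hK : IsRescaledZeroRangeProcess α χ P K) (hK0 : P.map (K 0) = equilibrium d N α χ a)
    (W : Config d N → ℝ) {Λ : ℝ}
    (hform : ∀ F : Config d N → ℝ, (∀ k ∉ boundedConfigs d N n, F k = 0) →
      ∑ k ∈ boundedConfigs d N n, weight α (a / χ) k * (F k * (generator α χ F k + W k * F k)) ≤
        Λ * ∑ k ∈ boundedConfigs d N n, weight α (a / χ) k * F k ^ 2)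
    {T : ℝ} (hT : 0 < T) (c : ℝ) :
    P {ω | K 0 ω ∈ boundedConfigs d N n ∧ c < ∫ t in (0 : ℝ)..T, W (K t ω)} ≤
      ENNReal.ofReal (Real.exp (T * Λ - c)) := by
  have hK0m : Measurable (K 0) := hK.measurable 0 le_rfl
  -- The total mass is one because the equilibrium is the law of `K 0`; no summation over
  -- configurations is required.
  have : IsProbabilityMeasure (equilibrium d N α χ a) :=
    hK0 ▸ Measure.isProbabilityMeasure_map hK0m.aemeasurable
  obtain ⟨C, hC, h₀, hh₀, hstep⟩ := exists_feynmanKacStep_bound hα hχ ha n W hform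
  set Z : ℕ → Ω → ℝ := fun m ω => boundedIndicator d N n (K 0 ω) * (∏ i ∈ Finset.range m,
    boundedIndicator d N n (K ((i + 1) * (T / m)) ω) *
      Real.exp (T / m * W (K ((i + 1) * (T / m)) ω))) *
    boundedIndicator d N n (K (m * (T / m)) ω) with hZ
  have hmeasK : ∀ (F : Config d N → ℝ) s, 0 ≤ s → Measurable fun ω => F (K s ω) := fun F s hs =>
    Measurable.of_discrete.comp (hK.measurable s hs)
  have hind : ∀ k, 0 ≤ boundedIndicator d N n k := fun k =>
    Set.indicator_nonneg (fun _ _ => zero_le_one) k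
  have hZ0 : ∀ m ω, 0 ≤ Z m ω := fun m ω =>
    mul_nonneg (mul_nonneg (hind _) (Finset.prod_nonneg fun i _ =>
      mul_nonneg (hind _) (Real.exp_pos _).le)) (hind _)
  have hZm : ∀ m, Measurable (Z m) := fun m =>
    ((hmeasK _ 0 le_rfl).mul (Finset.measurable_fun_prod _ fun i _ =>
      hmeasK (fun k => boundedIndicator d N n k * Real.exp (T / m * W k)) _
        (by positivity))).mul (hmeasK _ _ (by positivity))
  have hZint : ∀ m, Integrable (Z m) P := by
    intro m
    obtain ⟨B, hB⟩ := exists_bound_of_support (n := n)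
      (F := fun k => boundedIndicator d N n k * Real.exp (T / m * W k))
      fun k hk => by rw [boundedIndicator_of_notMem hk, zero_mul]
    refine Integrable.of_bound (hZm m).aestronglyMeasurable (1 * B ^ m * 1)
      (Eventually.of_forall fun ω => ?_)
    rw [Real.norm_eq_abs, hZ, abs_mul, abs_mul, Finset.abs_prod]
    have hB0 : 0 ≤ B := (abs_nonneg _).trans (hB (K 0 ω))
    refine mul_le_mul (mul_le_mul (abs_boundedIndicator_le _) ?_
      (Finset.prod_nonneg fun _ _ => abs_nonneg _) zero_le_one) (abs_boundedIndicator_le _)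
      (abs_nonneg _) (by positivity)
    refine (Finset.prod_le_prod (fun _ _ => abs_nonneg _) fun i _ => hB _).trans ?_
    simp
  have hexpect : ∀ᶠ m : ℕ in atTop, ∫⁻ ω, ENNReal.ofReal (Z m ω) ∂P ≤
      ENNReal.ofReal (Real.exp (T * Λ + C * T ^ 2 / 2 / m)) := by
    have hsmall : ∀ᶠ m : ℕ in atTop, T / m < h₀ :=
      (tendsto_const_div_atTop_nhds_zero_nat T).eventually_lt_const hh₀
    filter_upwards [hsmall, eventually_gt_atTop 0] with m hm hm0
    have hm' : (0 : ℝ) < m := by exact_mod_cast hm0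
    have hh : 0 ≤ T / m := by positivity
    rw [← ofReal_integral_eq_lintegral_ofReal (hZint m) (Eventually.of_forall (hZ0 m))]
    refine ENNReal.ofReal_le_ofReal ?_
    rw [hZ, integral_prod_eq_iterate hα hK W hh m (n := n)
      fun k hk => boundedIndicator_of_notMem hk]
    have hmap : ∫ ω, boundedIndicator d N n (K 0 ω) *
        (feynmanKacStep α χ W (T / m))^[m] (boundedIndicator d N n) (K 0 ω) ∂P =
        ∑ k ∈ boundedConfigs d N n, weight α (a / χ) k *
          (feynmanKacStep α χ W (T / m))^[m] (boundedIndicator d N n) k := by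
      rw [← integral_equilibrium hα hχ ha, ← hK0, integral_map hK0m.aemeasurable
        Measurable.of_discrete.aestronglyMeasurable]
    rw [hmap]
    refine (sum_iterate_feynmanKacStep_le hα hχ ha (sum_weight_le_one hα hχ ha)
      (hstep _ hh hm.le) m).trans (le_of_eq ?_)
    congr 1
    field_simp
  -- Fatou's lemma suffices, as only an upper bound is wanted; the error `C T² / (2m)` disappears in
  -- the limit.
  have hfatou : ∫⁻ ω, liminf (fun m => ENNReal.ofReal (Z m ω)) atTop ∂P ≤
      ENNReal.ofReal (Real.exp (T * Λ)) := by
    refine (lintegral_liminf_le fun m => (hZm m).ennreal_ofReal).trans ?_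
    have hlim : Tendsto (fun m : ℕ => ENNReal.ofReal (Real.exp (T * Λ + C * T ^ 2 / 2 / m))) atTop
        (𝓝 (ENNReal.ofReal (Real.exp (T * Λ)))) := by
      refine ENNReal.tendsto_ofReal ((Real.continuous_exp.tendsto _).comp ?_)
      simpa using (tendsto_const_div_atTop_nhds_zero_nat (C * T ^ 2 / 2)).const_add (T * Λ)
    exact (liminf_le_liminf hexpect).trans hlim.liminf_eq.le
  have hpath : ∀ᵐ ω ∂P, K 0 ω ∈ boundedConfigs d N n →
      Tendsto (fun m => ENNReal.ofReal (Z m ω)) atTop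
        (𝓝 (ENNReal.ofReal (Real.exp (∫ t in (0 : ℝ)..T, W (K t ω))))) := by
    filter_upwards [ae_mem_boundedConfigs (n := n) hα hK, hK.right_continuous] with ω hω hright h0
    have hmem := hω h0
    have hW : ∀ t, 0 ≤ t → |W (K t ω)| ≤ ∑ k ∈ boundedConfigs d N n, |W k| := fun t ht =>
      Finset.single_le_sum (f := fun k => |W k|) (fun _ _ => abs_nonneg _) (hmem t ht)
    have hriemann := tendsto_riemannSum hT hW fun t ht => (hright t ht).mono fun s hs => by rw [hs]
    refine ENNReal.tendsto_ofReal (((Real.continuous_exp.tendsto _).comp hriemann).congr fun m => ?_)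
    simp only [hZ, Function.comp_apply, boundedIndicator_of_mem h0]
    rw [boundedIndicator_of_mem (hmem _ (by positivity)), Real.exp_sum, one_mul, mul_one]
    refine Finset.prod_congr rfl fun i _ => ?_
    rw [boundedIndicator_of_mem (hmem _ (by positivity)), one_mul]
  -- Passing to the liminf replaces the path integral by a measurable function, to which Markov's
  -- inequality applies.
  have hsub : P {ω | K 0 ω ∈ boundedConfigs d N n ∧ c < ∫ t in (0 : ℝ)..T, W (K t ω)} ≤
      P {ω | ENNReal.ofReal (Real.exp c) ≤ liminf (fun m => ENNReal.ofReal (Z m ω)) atTop} := by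
    refine measure_mono_ae ?_
    filter_upwards [hpath] with ω hω hmem
    have hlim := (hω hmem.1).liminf_eq
    change ENNReal.ofReal (Real.exp c) ≤ liminf (fun m => ENNReal.ofReal (Z m ω)) atTop
    rw [hlim]
    exact ENNReal.ofReal_le_ofReal (Real.exp_le_exp.2 hmem.2.le)
  have hmarkov := mul_meas_ge_le_lintegral (μ := P)
    (Measurable.liminf fun m => (hZm m).ennreal_ofReal) (ENNReal.ofReal (Real.exp c))
  have hpos : 0 < Real.exp c := Real.exp_pos c
  rw [Real.exp_sub, ENNReal.ofReal_div_of_pos hpos,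
    ENNReal.le_div_iff_mul_le (Or.inl (by simpa using hpos)) (Or.inl ENNReal.ofReal_ne_top), mul_comm]
  exact (mul_le_mul_right hsub _).trans (hmarkov.trans hfatou)

end MarkovDynamics

/-! ### Exponential tail of the particle number at equilibrium -/

section Tail

variable {d N : ℕ} [NeZero N] {α χ a : ℝ} {n : ℕ}

theorem siteWeight_mul_exp (α : ℝ) {u : ℝ} (hu : 0 < u) (j : ℕ) :
    siteWeight α u j * Real.exp (α * j) = siteWeight α (u * Real.exp 1) j := by
  rw [siteWeight_eq_rpow α hu, siteWeight_eq_rpow α (by positivity), mul_pow, mul_div_right_comm,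
    Real.mul_rpow (by positivity) (by positivity), ← Real.exp_nat_mul, ← Real.exp_mul, mul_one,
    mul_comm α]

/-- Tilting by `exp (α · particle number)` changes `u` to `e u` in each site weight. The
normalisation is dropped since it is at least one, and enclosing `s` in a product set factorises the
sum over sites. -/
theorem sum_weight_mul_exp_le (hα : 1 ≤ α) {u : ℝ} (hu : 0 < u) (s : Finset (Config d N)) :
    ∑ k ∈ s, weight α u k * Real.exp (α * ∑ x, (k x : ℝ)) ≤
      Real.exp (α * (u * Real.exp 1) * (N : ℝ) ^ d) := by
  have hu' : 0 < u * Real.exp 1 := by positivity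
  set m := ∑ k ∈ s, ∑ x, k x with hm
  have hsub : s ⊆ Fintype.piFinset fun _ : Torus d N => Finset.range (m + 1) := fun k hk => by
    rw [Fintype.mem_piFinset]
    intro x
    have h1 := Finset.single_le_sum (f := k) (fun _ _ => Nat.zero_le _) (Finset.mem_univ x)
    have h2 := Finset.single_le_sum (f := fun k : Config d N => ∑ x, k x)
      (fun _ _ => Nat.zero_le _) hk
    exact Finset.mem_range.2 (Nat.lt_succ_of_le (h1.trans h2))
  have hterm : ∀ k : Config d N, weight α u k * Real.exp (α * ∑ x, (k x : ℝ)) ≤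
      ∏ x, siteWeight α (u * Real.exp 1) (k x) := fun k => by
    rw [Finset.mul_sum, Real.exp_sum, weight, ← Finset.prod_mul_distrib]
    refine Finset.prod_le_prod (fun x _ => ?_) fun x _ => ?_
    · have := siteWeight_pos α hu (k x)
      have := one_le_partitionFunction hα hu
      positivity
    · rw [← siteWeight_mul_exp α hu]
      gcongr
      exact div_le_self (siteWeight_pos α hu _).le (one_le_partitionFunction hα hu)
  calc _ ≤ ∑ k ∈ s, ∏ x, siteWeight α (u * Real.exp 1) (k x) :=
        Finset.sum_le_sum fun k _ => hterm k
    _ ≤ ∑ k ∈ Fintype.piFinset fun _ : Torus d N => Finset.range (m + 1),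
        ∏ x, siteWeight α (u * Real.exp 1) (k x) :=
        Finset.sum_le_sum_of_subset_of_nonneg hsub fun k _ _ =>
          Finset.prod_nonneg fun x _ => (siteWeight_pos α hu' _).le
    _ = ∏ _x : Torus d N, ∑ j ∈ Finset.range (m + 1), siteWeight α (u * Real.exp 1) j :=
        (Finset.prod_univ_sum _ _).symm
    _ ≤ ∏ _x : Torus d N, Real.exp (α * (u * Real.exp 1)) :=
        Finset.prod_le_prod (fun x _ => Finset.sum_nonneg fun j _ => (siteWeight_pos α hu' j).le)
          fun x _ => sum_siteWeight_le hα hu' _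
    _ = _ := by
        rw [Finset.prod_const, Finset.card_univ, card_torus, ← Real.exp_nat_mul]
        push_cast
        rw [mul_comm]

theorem equilibrium_compl_boundedConfigs_le (hα : 1 ≤ α) (hχ : 0 < χ) (ha : 0 < a) {θ : ℝ}
    (hn : n = ⌊θ⌋₊) (hθ : 0 ≤ θ) :
    equilibrium d N α χ a (boundedConfigs d N n : Set (Config d N))ᶜ ≤
      ENNReal.ofReal (Real.exp (α * (a / χ * Real.exp 1 * (N : ℝ) ^ d - θ))) := by
  have hw : ∀ k : Config d N, 0 < weight α (a / χ) k := weight_pos hα (div_pos ha hχ)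
  rw [equilibrium, Measure.sum_apply _ (Set.to_countable _).measurableSet]
  have hterm : ∀ k : Config d N, (ENNReal.ofReal (∏ x : Torus d N,
      siteWeight α (a / χ) (k x) / partitionFunction α (a / χ)) • Measure.dirac k)
        (boundedConfigs d N n : Set (Config d N))ᶜ ≤
      ENNReal.ofReal (Real.exp (-(α * θ)) *
        (weight α (a / χ) k * Real.exp (α * ∑ x, (k x : ℝ)))) := fun k => by
    by_cases hk : k ∈ boundedConfigs d N n
    · simp [hk]
    · have hlt : θ < ∑ x, (k x : ℝ) := by
        rw [mem_boundedConfigs, not_le, hn, Nat.floor_lt hθ] at hk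
        exact_mod_cast hk
      rw [Measure.smul_apply, Measure.dirac_apply' _ (Set.to_countable _).measurableSet,
        Set.indicator_of_mem (by simpa using hk), Pi.one_apply, smul_eq_mul, mul_one]
      refine ENNReal.ofReal_le_ofReal ?_
      change weight α (a / χ) k ≤ _
      rw [mul_left_comm, ← Real.exp_add]
      refine le_mul_of_one_le_right (hw k).le (Real.one_le_exp ?_)
      nlinarith
  refine (ENNReal.tsum_le_tsum hterm).trans ?_
  rw [ENNReal.tsum_eq_iSup_sum]
  refine iSup_le fun s => ?_
  rw [← ENNReal.ofReal_sum_of_nonneg fun k _ => mul_nonneg (Real.exp_pos _).le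
    (mul_nonneg (hw k).le (Real.exp_pos _).le)]
  refine ENNReal.ofReal_le_ofReal ?_
  rw [← Finset.mul_sum]
  calc _ ≤ Real.exp (-(α * θ)) * Real.exp (α * (a / χ * Real.exp 1) * (N : ℝ) ^ d) :=
        mul_le_mul_of_nonneg_left (sum_weight_mul_exp_le hα (div_pos ha hχ) s) (Real.exp_pos _).le
    _ = _ := by rw [← Real.exp_add]; congr 1; ring

end Tail

/-! ### Choice of constants and passage to the limit -/

/-- The superexponential estimate at a fixed size of the system. -/
theorem exists_measure_replacementError_le {d : ℕ} (hd : 1 ≤ d) {α : ℝ} (hα : 1 ≤ α) {T : ℝ}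
    (hT : 0 < T) {a : ℝ} (ha : 0 < a) {δ : ℝ} (hδ : 0 < δ) {R : ℝ} (hR : 0 < R) :
    ∃ ε₀ > (0 : ℝ), ∃ χ₀ > (0 : ℝ), ∀ ε : ℝ, 0 < ε → ε ≤ ε₀ → ∀ χ : ℝ, 0 < χ → χ ≤ χ₀ →
      ∀ (N : ℕ) [NeZero N], 2 * ⌊ε * N⌋₊ + 1 ≤ N →
      ∀ {Ω : Type*} [MeasurableSpace Ω] (P : Measure Ω) [IsProbabilityMeasure P]
        (K : ℝ → Ω → Config d N), IsRescaledZeroRangeProcess α χ P K →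
        P.map (K 0) = equilibrium d N α χ a →
      P {ω | δ < ∫ t in (0 : ℝ)..T, (1 / (N : ℝ) ^ d) * ∑ x : Torus d N,
          replacementError α ε (rescale χ (K t ω)) x} ≤
        ENNReal.ofReal (2 * Real.exp (-R * ((N : ℝ) ^ d / χ))) := by
  -- With `q = N^d / χ`, the tail exponent is `α (a e - M) q = -α R q ≤ -R q`. With `β = 1 / T` and
  -- this `γ`, the Feynman-Kac exponent is `q - (R + 1) q = -R q`.
  set M := a * Real.exp 1 + R with hM
  set γ := (R + 1) / δ with hγ
  obtain ⟨ε₀, hε₀, χ₀, hχ₀, hvar⟩ := exists_variational_bound (γ := γ) (β := 1 / T) (M := M) hd hα ha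
    (by positivity) (by positivity) (by positivity)
  refine ⟨ε₀, hε₀, χ₀, hχ₀, ?_⟩
  intro ε hε hεle χ hχ hχle N _ hN Ω _ P _ K hK hK0
  have hN0 : (0 : ℝ) < N := by exact_mod_cast NeZero.pos N
  set q := (N : ℝ) ^ d / χ with hq
  have hq0 : 0 < q := by positivity
  have hθ : 0 ≤ M * q := by positivity
  set n := ⌊M * q⌋₊ with hn
  have hχn : χ * n ≤ M * (N : ℝ) ^ d := by
    calc χ * n ≤ χ * (M * q) := by gcongr; exact Nat.floor_le hθ
      _ = _ := by rw [hq]; field_simp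
  set W : Config d N → ℝ := fun k => γ / χ * ∑ x, replacementError α ε (rescale χ k) x with hW
  have hfk := measure_additiveFunctional_le hα hχ ha hK hK0 (n := n) W
    (Λ := 1 / T * (N : ℝ) ^ d / χ) (fun F hF => by
      simpa only [hW, Finset.sum_mul, mul_assoc] using hvar ε hε hεle χ hχ hχle N hN n hχn F hF)
    hT (γ * q * δ)
  have htail : P {ω | K 0 ω ∉ boundedConfigs d N n} ≤ ENNReal.ofReal (Real.exp (-R * q)) := by
    have h1 : P {ω | K 0 ω ∉ boundedConfigs d N n} =
        equilibrium d N α χ a (boundedConfigs d N n : Set (Config d N))ᶜ := by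
      rw [← hK0, Measure.map_apply (hK.measurable 0 le_rfl) (Set.to_countable _).measurableSet]
      rfl
    rw [h1]
    refine (equilibrium_compl_boundedConfigs_le hα hχ ha hn hθ).trans
      (ENNReal.ofReal_le_ofReal (Real.exp_le_exp.2 ?_))
    have h2 : a / χ * Real.exp 1 * (N : ℝ) ^ d - M * q = -(R * q) := by rw [hM, hq]; ring
    rw [h2]
    nlinarith [mul_pos hR hq0]
  have hexp : T * (1 / T * (N : ℝ) ^ d / χ) - γ * q * δ = -R * q := by
    rw [hγ, hq]; field_simp; ring
  rw [hexp] at hfk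
  have hsub : {ω | δ < ∫ t in (0 : ℝ)..T, (1 / (N : ℝ) ^ d) * ∑ x : Torus d N,
      replacementError α ε (rescale χ (K t ω)) x} ⊆
      {ω | K 0 ω ∈ boundedConfigs d N n ∧ γ * q * δ < ∫ t in (0 : ℝ)..T, W (K t ω)} ∪
        {ω | K 0 ω ∉ boundedConfigs d N n} := by
    intro ω hω
    by_cases hmem : K 0 ω ∈ boundedConfigs d N n
    · refine Or.inl ⟨hmem, ?_⟩
      have hWeq : ∀ t, W (K t ω) = γ * q * ((1 / (N : ℝ) ^ d) * ∑ x : Torus d N,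
          replacementError α ε (rescale χ (K t ω)) x) := fun t => by
        simp only [hW, hq]; field_simp
      rw [intervalIntegral.integral_congr fun t _ => hWeq t, intervalIntegral.integral_const_mul]
      exact mul_lt_mul_of_pos_left hω (by positivity)
    · exact Or.inr hmem
  refine (measure_mono hsub).trans ((measure_union_le _ _).trans ((add_le_add hfk htail).trans ?_))
  rw [two_mul, ENNReal.ofReal_add (Real.exp_pos _).le (Real.exp_pos _).le]

end ZeroRange

theorem theorem2 (d : ℕ) (hd : 1 ≤ d) (α : ℝ) (hα : 1 ≤ α) (tfin : ℝ) (htfin : 0 < tfin)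
    (χ : ℕ+ → ℝ) (hχpos : ∀ N, 0 < χ N) (hχ : Tendsto χ atTop (𝓝 0))
    (a : ℝ) (ha : 0 < a)
    {Ω : Type*} [MeasurableSpace Ω] (P : Measure Ω) [IsProbabilityMeasure P]
    (K : (N : ℕ+) → ℝ → Ω → ZeroRange.Config d N)
    (hK : ∀ N : ℕ+, ZeroRange.IsRescaledZeroRangeProcess α (χ N) P (K N))
    (hK0 : ∀ N : ℕ+, P.map (K N 0) = ZeroRange.equilibrium d N α (χ N) a)
    (δ : ℝ) (hδ : 0 < δ) :
    limsup (fun ε : ℝ =>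
      limsup (fun N : ℕ+ =>
        ((χ N / (N : ℝ) ^ d : ℝ) : EReal) * ENNReal.log (P {ω | δ <
          ∫ t in (0 : ℝ)..tfin, (1 / (N : ℝ) ^ d) * ∑ x : ZeroRange.Torus d N,
            ZeroRange.replacementError α ε (ZeroRange.rescale (χ N) (K N t ω)) x}))
        atTop)
      (𝓝[>] (0 : ℝ)) = ⊥ := by
  rw [EReal.eq_bot_iff_forall_lt]
  intro y
  -- One unit absorbs the contribution of `log 2` from the factor 2, the other gives the strict
  -- inequality below `y`.
  set R : ℝ := |y| + 2 with hR
  have hR0 : 0 < R := by positivity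
  obtain ⟨ε₀, hε₀, χ₀, hχ₀, hbound⟩ :=
    ZeroRange.exists_measure_replacementError_le hd hα htfin ha hδ hR0
  refine lt_of_le_of_lt (b := ((y - 1 : ℝ) : EReal)) ?_ (by exact_mod_cast sub_one_lt y)
  refine limsup_le_of_le (by isBoundedDefault) ?_
  -- With `ε ≤ 1 / 4` and `N ≥ 2`, `2εN + 1 ≤ N`, so the box does not wrap around the torus.
  have hεev : ∀ᶠ ε : ℝ in 𝓝[>] 0, ε ∈ Set.Ioc 0 (min ε₀ (1 / 4)) :=
    Ioc_mem_nhdsGT (by positivity)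
  filter_upwards [hεev] with ε hε
  refine limsup_le_of_le (by isBoundedDefault) ?_
  filter_upwards [hχ.eventually_lt_const hχ₀, hχ.eventually_lt_const one_pos,
    eventually_ge_atTop (2 : ℕ+)] with N hN₀ hN₁ hN₂
  have hN2 : (2 : ℝ) ≤ ((N : ℕ) : ℝ) := by exact_mod_cast hN₂
  have hfloor : 2 * ⌊ε * (N : ℕ)⌋₊ + 1 ≤ (N : ℕ) := by
    have h1 := Nat.floor_le (show 0 ≤ ε * ((N : ℕ) : ℝ) from mul_nonneg hε.1.le (by positivity))
    have h2 : ε * ((N : ℕ) : ℝ) ≤ 1 / 4 * ((N : ℕ) : ℝ) :=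
      mul_le_mul_of_nonneg_right (hε.2.trans (min_le_right _ _)) (by positivity)
    have h3 : (2 * ⌊ε * (N : ℕ)⌋₊ + 1 : ℝ) ≤ ((N : ℕ) : ℝ) := by linarith
    exact_mod_cast h3
  have hP := hbound ε hε.1 (hε.2.trans (min_le_left _ _)) (χ N) (hχpos N) hN₀.le N hfloor P (K N)
    (hK N) (hK0 N)
  have hNd : (1 : ℝ) ≤ ((N : ℕ) : ℝ) ^ d := one_le_pow₀ (by linarith)
  have hcoef : 0 < χ N / ((N : ℕ) : ℝ) ^ d := div_pos (hχpos N) (by positivity)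
  have hlog := ENNReal.log_monotone hP
  rw [ENNReal.log_ofReal_of_pos (by positivity)] at hlog
  refine (mul_le_mul_of_nonneg_left hlog (by exact_mod_cast hcoef.le)).trans ?_
  rw [← EReal.coe_mul, EReal.coe_le_coe_iff, Real.log_mul (by norm_num) (Real.exp_pos _).ne',
    Real.log_exp, mul_add]
  have h1 : χ N / ((N : ℕ) : ℝ) ^ d * (-R * (((N : ℕ) : ℝ) ^ d / χ N)) = -R := by
    have := (hχpos N).ne'
    field_simp
  have h2 : χ N / ((N : ℕ) : ℝ) ^ d * Real.log 2 ≤ 1 := by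
    have h3 : χ N / ((N : ℕ) : ℝ) ^ d ≤ 1 := (div_le_one (by positivity)).2 (by linarith)
    have h4 : Real.log 2 ≤ 1 := by linarith [Real.log_two_lt_d9]
    exact mul_le_one₀ h3 (Real.log_nonneg (by norm_num)) h4
  rw [h1]
  linarith [neg_abs_le y]
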